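/- Let $p,m\ge 1$, $q\ge 0$ be integers, $n=q+m$, $r=\min\{p,m\}$, $v=\max\{p,m\}$. Let $\Sigma$ be a real symmetric positive definite $p\times p$ matrix, $\theta$ a real $q\times p$ matrix, and $f\ge 0$ a measurable function such that the random pair $(Z,U)$, with $Z$ a $q\times p$ and $U$ an $m\times p$ matrix, has the probability density, with respect to Lebesgue measure, $$(z,u)\mapsto |\Sigma|^{-n/2}\,f\big(\mathrm{tr}\,(z-\theta)\Sigma^{-1}(z-\theta)^\top+\mathrm{tr}\,u\Sigma^{-1}u^\top\big).$$ Write $E$ for the expectation under this density. Let $F^*(t)=\frac12\int_t^\infty f(\nu)\,d\nu$ for $t\ge 0$, let $$K^*=\int |\Sigma|^{-n/2}F^*\big(\mathrm{tr}\,(z-\theta)\Sigma^{-1}(z-\theta)^\top+\mathrm{tr}\,u\Sigma^{-1}u^\top\big)\,dz\,du,$$ assume $K^*<\infty$, and write $E^*$ for the expectation under the probability density $$(z,u)\mapsto \frac1{K^*}|\Sigma|^{-n/2}F^*\big(\mathrm{tr}\,(z-\theta)\Sigma^{-1}(z-\theta)^\top+\mathrm{tr}\,u\Sigma^{-1}u^\top\big).$$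 Let $S=U^\top U=HLH^\top$ be the eigenvalue decomposition of $S$, where $H$ is $p\times r$ with $H^\top H=I_r$ and $L=\mathrm{diag}(l_1,\dots,l_r)$ holds the $r$ largest eigenvalues of $S$ in decreasing order (almost surely $l_1>\dots>l_r>0$). Let $\Phi(L)=\mathrm{diag}(\phi_1,\dots,\phi_r)$, where each $\phi_i=\phi_i(l_1,\dots,l_r)$ is a differentiable real function on $\{l_1>\dots>l_r>0\}$. Assume that $E\big[|\mathrm{tr}(\Sigma^{-1}HL\Phi(L)H^\top)|\big]<\infty$ and that the expectations of the individual terms on the right-hand side below exist, that is, $E^*[|\phi_i|]<\infty$, $E^*\big[|l_i\,\partial\phi_i/\partial l_i|\big]<\infty$ and $E^*\big[|(l_i\phi_i-l_j\phi_j)/(l_i-l_j)|\big]<\infty$ for all $i$ and all $j\ne i$. Then $$E\big[\mathrm{tr}(\Sigma^{-1}HL\Phi(L)H^\top)\big]=K^*\,E^*\Big[\sum_{i=1}^r\Big((v-r+1)\,\phi_i+2\,l_i\,\frac{\partial\phi_i}{\partial l_i}+\sum_{j\ne i}\frac{l_i\phi_i-l_j\phi_j}{l_i-l_j}\Big)\Big].$$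 -/

import Mathlib

open MeasureTheory Matrix
open scoped ENNReal

namespace EllipticalModel

/-- `tr (z - θ) Σ⁻¹ (z - θ)ᵀ + tr u Σ⁻¹ uᵀ` for a `q × p` matrix `z` and an `m × p` matrix `u`. -/
noncomputable def quadForm {p q m : ℕ} (Sig : Matrix (Fin p) (Fin p) ℝ)
    (θ : Matrix (Fin q) (Fin p) ℝ) (x : (Fin q → Fin p → ℝ) × (Fin m → Fin p → ℝ)) : ℝ :=
  ((Matrix.of x.1 - θ) * Sig⁻¹ * (Matrix.of x.1 - θ)ᵀ).trace
    + (Matrix.of x.2 * Sig⁻¹ * (Matrix.of x.2)ᵀ).trace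

/-- `(z, u) ↦ |Σ|^(-n/2) g (tr (z - θ) Σ⁻¹ (z - θ)ᵀ + tr u Σ⁻¹ uᵀ)`, where `n = q + m`. -/
noncomputable def ellDensity {p q m : ℕ} (Sig : Matrix (Fin p) (Fin p) ℝ)
    (θ : Matrix (Fin q) (Fin p) ℝ) (g : ℝ → ℝ≥0∞)
    (x : (Fin q → Fin p → ℝ) × (Fin m → Fin p → ℝ)) : ℝ≥0∞ :=
  ENNReal.ofReal (Sig.det ^ (-((q + m : ℕ) : ℝ) / 2)) * g (quadForm Sig θ x)

/-- The distribution of `(Z, U)`, with generating function `f`; its expectation is `E`. -/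
noncomputable def law {p q : ℕ} (m : ℕ) (Sig : Matrix (Fin p) (Fin p) ℝ)
    (θ : Matrix (Fin q) (Fin p) ℝ) (f : ℝ → ℝ) :
    Measure ((Fin q → Fin p → ℝ) × (Fin m → Fin p → ℝ)) :=
  volume.withDensity (ellDensity Sig θ fun t => ENNReal.ofReal (f t))

/-- `F*(t) = (1/2) ∫_t^∞ f(ν) dν`, as an extended nonnegative number. -/
noncomputable def Fstar (f : ℝ → ℝ) (t : ℝ) : ℝ≥0∞ :=
  2⁻¹ * ∫⁻ ν in Set.Ioi t, ENNReal.ofReal (f ν)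

/-- The normalizing constant `K*`, i.e. the total mass of
`|Σ|^(-n/2) F*(tr (z - θ) Σ⁻¹ (z - θ)ᵀ + tr u Σ⁻¹ uᵀ)`. -/
noncomputable def Kstar {p q : ℕ} (m : ℕ) (Sig : Matrix (Fin p) (Fin p) ℝ)
    (θ : Matrix (Fin q) (Fin p) ℝ) (f : ℝ → ℝ) : ℝ≥0∞ :=
  ∫⁻ x : (Fin q → Fin p → ℝ) × (Fin m → Fin p → ℝ), ellDensity Sig θ (Fstar f) x

/-- The distribution with density `(1/K*) |Σ|^(-n/2) F*(...)`; its expectation is `E*`. -/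
noncomputable def lawStar {p q : ℕ} (m : ℕ) (Sig : Matrix (Fin p) (Fin p) ℝ)
    (θ : Matrix (Fin q) (Fin p) ℝ) (f : ℝ → ℝ) :
    Measure ((Fin q → Fin p → ℝ) × (Fin m → Fin p → ℝ)) :=
  volume.withDensity fun x => (Kstar m Sig θ f)⁻¹ * ellDensity Sig θ (Fstar f) x

/-- `S = uᵀ u`. -/
def scatter {p m : ℕ} (u : Fin m → Fin p → ℝ) : Matrix (Fin p) (Fin p) ℝ :=
  (Matrix.of u)ᵀ * Matrix.of u

theorem scatter_isHermitian {p m : ℕ} (u : Fin m → Fin p → ℝ) : (scatter u).IsHermitian := by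
  have h := Matrix.isHermitian_conjTranspose_mul_self (Matrix.of u)
  rwa [Matrix.conjTranspose_eq_transpose_of_trivial] at h

/-- The `r = min p m` largest eigenvalues `l₁ ≥ ... ≥ l_r` of `S = uᵀ u`, with multiplicity
(`Matrix.IsHermitian.eigenvalues₀` lists all `p` eigenvalues in decreasing order). -/
noncomputable def eig {p m : ℕ} (u : Fin m → Fin p → ℝ) (i : Fin (min p m)) : ℝ :=
  (scatter_isHermitian u).eigenvalues₀
    ⟨i, by rw [Fintype.card_fin]; exact lt_of_lt_of_le i.2 (min_le_left p m)⟩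

/-- `S = H L Hᵀ` with `H` semi-orthogonal (`p × r`) and `L = diag(l₁, ..., l_r)`. -/
def IsEigenvectorMatrix {p m : ℕ} (u : Fin m → Fin p → ℝ)
    (H : Matrix (Fin p) (Fin (min p m)) ℝ) : Prop :=
  Hᵀ * H = 1 ∧ scatter u = H * Matrix.diagonal (eig u) * Hᵀ

/-- The domain of the functions `φ_i`: all `(l₁, ..., l_r)` with `l₁ > ... > l_r > 0`. -/
def chamber (r : ℕ) : Set (Fin r → ℝ) := {l | StrictAnti l ∧ ∀ i, 0 < l i}

/-- `∂φ/∂l_i` at `l`. -/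
noncomputable def partialDeriv {r : ℕ} (φ : (Fin r → ℝ) → ℝ) (i : Fin r) (l : Fin r → ℝ) : ℝ :=
  fderiv ℝ φ l (Pi.single i 1)

/-- `tr (Σ⁻¹ H L Φ(L) Hᵀ)` with `L = diag(l)` and `Φ(L) = diag(φ₁(l), ..., φ_r(l))`. -/
noncomputable def traceTerm {p r : ℕ} (Sig : Matrix (Fin p) (Fin p) ℝ)
    (H : Matrix (Fin p) (Fin r) ℝ) (l : Fin r → ℝ) (φ : Fin r → (Fin r → ℝ) → ℝ) : ℝ :=
  (Sig⁻¹ * (H * Matrix.diagonal l * Matrix.diagonal (fun i => φ i l) * Hᵀ)).trace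

end EllipticalModel

/-!
Condition on `z`, so that only the density of `u` matters, as a function of `tr u Σ⁻¹ uᵀ`. Along the
vector field `u ↦ u H Φ(L) Hᵀ` the derivative of this quadratic form is twice the trace term, while
the divergence of the field is the Stein–Haff expression. Since the derivative of `F*` is `-f / 2`,
the identity is integration by parts of the field against the weight `F*`.

The eigenvalues are smooth only off the zero set of a polynomial, the discriminant, so the field is
cut off near it. The cutoff leaves no trace in the limit, because the logarithmic derivative of the
discriminant along the field is a combination of the `φᵢ` and of the quotients
`(lᵢφᵢ - lⱼφⱼ)/(lᵢ - lⱼ)`, whose integrability is assumed. For the divergence, interpolation in `L`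
writes the field as a combination of the polynomial fields `u ↦ u (uᵀ u)ⁿ`. A general `f` is reached
from truncated weights that vanish where the tail of `f` is small.
-/

namespace EllipticalModel

open Filter Topology
open scoped NNReal

section Eigenvalues

open scoped ComplexOrder in
theorem eigenvalues₀_eq_zero_of_rank_le {𝕜 n : Type*} [RCLike 𝕜] [Fintype n] [DecidableEq n]
    {A : Matrix n n 𝕜} (hA : A.PosSemidef) {k : Fin (Fintype.card n)} (hk : A.rank ≤ k) :
    hA.isHermitian.eigenvalues₀ k = 0 := by
  let e := Fintype.equivOfCardEq (Fintype.card_fin (Fintype.card n))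
  have heig (j) : hA.isHermitian.eigenvalues (e j) = hA.isHermitian.eigenvalues₀ j := by
    simp only [Matrix.IsHermitian.eigenvalues, e, Equiv.symm_apply_apply]
  by_contra hne
  have hpos : 0 < hA.isHermitian.eigenvalues₀ k :=
    (heig k ▸ hA.eigenvalues_nonneg (e k)).lt_of_ne' hne
  have hcard : Fintype.card (Fin (k + 1)) ≤ A.rank := by
    rw [hA.isHermitian.rank_eq_card_non_zero_eigs]
    refine Fintype.card_le_of_injective
      (fun j => ⟨e (Fin.castLE k.2 j), ?_⟩) fun i j hij => ?_
    · rw [heig]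
      refine (hpos.trans_le (hA.isHermitian.eigenvalues₀_antitone ?_)).ne'
      exact Fin.le_def.mpr (Nat.lt_succ_iff.mp j.2)
    · simpa using hij
  rw [Fintype.card_fin] at hcard
  omega

variable {p m : ℕ}

theorem posSemidef_scatter (u : Fin m → Fin p → ℝ) : (scatter u).PosSemidef := by
  simpa only [scatter, conjTranspose_eq_transpose_of_trivial] using
    posSemidef_conjTranspose_mul_self (Matrix.of u)

theorem rank_scatter_le (u : Fin m → Fin p → ℝ) : (scatter u).rank ≤ min p m :=
  le_min (rank_le_height _)
    ((rank_mul_le_right _ _).trans (rank_le_height (Matrix.of u)))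

theorem eig_nonneg (u : Fin m → Fin p → ℝ) (i : Fin (min p m)) : 0 ≤ eig u i := by
  have h := (posSemidef_scatter u).eigenvalues_nonneg
    (Fintype.equivOfCardEq (Fintype.card_fin _) ⟨i, by
      rw [Fintype.card_fin]; exact i.2.trans_le (min_le_left p m)⟩)
  rwa [Matrix.IsHermitian.eigenvalues, Equiv.symm_apply_apply] at h

theorem eig_antitone (u : Fin m → Fin p → ℝ) : Antitone (eig u) := fun _ _ hij =>
  (scatter_isHermitian u).eigenvalues₀_antitone hij

theorem exists_isEigenvectorMatrix (u : Fin m → Fin p → ℝ) : ∃ H, IsEigenvectorMatrix u H := by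
  let hS := scatter_isHermitian u
  let U : Matrix (Fin p) (Fin p) ℝ := hS.eigenvectorUnitary
  let ι : Fin (min p m) → Fin p := fun i => Fintype.equivOfCardEq (Fintype.card_fin _)
    (Fin.castLE ((min_le_left p m).trans_eq (Fintype.card_fin p).symm) i)
  have hι : Function.Injective ι :=
    (Equiv.injective _).comp (Fin.castLE_injective _)
  have hU : Uᵀ * U = 1 := by
    have h := Unitary.coe_star_mul_self hS.eigenvectorUnitary
    rwa [star_eq_conjTranspose, conjTranspose_eq_transpose_of_trivial] at h
  have heig (i) : hS.eigenvalues (ι i) = eig u i := by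
    simp only [Matrix.IsHermitian.eigenvalues, ι, Equiv.symm_apply_apply]
    rfl
  have hzero (k) (hk : k ∉ Set.range ι) : hS.eigenvalues k = 0 := by
    refine eigenvalues₀_eq_zero_of_rank_le (posSemidef_scatter u)
      ((rank_scatter_le u).trans (not_lt.mp fun hlt => hk ⟨⟨_, hlt⟩, ?_⟩))
    exact Equiv.apply_symm_apply _ k
  refine ⟨U.submatrix id ι, ?_, ?_⟩
  · rw [transpose_submatrix, ← submatrix_mul _ _ _ id _ Function.bijective_id, hU,
      submatrix_one _ hι]
  · have hspec : scatter u = U * diagonal hS.eigenvalues * Uᵀ := by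
      have h := hS.spectral_theorem
      rwa [Unitary.conjStarAlgAut_apply, star_eq_conjTranspose,
        conjTranspose_eq_transpose_of_trivial] at h
    ext a b
    nth_rw 1 [hspec]
    simp only [mul_apply (M := _ * _), mul_diagonal, transpose_apply, submatrix_apply, id_eq]
    refine (Fintype.sum_of_injective ι hι _ _ (fun k hk => ?_) fun i => ?_).symm
    · simp only [hzero k hk, mul_zero, zero_mul]
    · rw [← heig i]

theorem mul_diagonal_mul_transpose_pow {r : ℕ} {H : Matrix (Fin p) (Fin r) ℝ} (hH : Hᵀ * H = 1)
    (l : Fin r → ℝ) (n : ℕ) :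
    (H * diagonal l * Hᵀ) ^ (n + 1) = H * diagonal (fun i => l i ^ (n + 1)) * Hᵀ := by
  induction n with
  | zero => simp only [zero_add, pow_one]
  | succ n ih =>
    calc (H * diagonal l * Hᵀ) ^ (n + 1 + 1)
        = H * diagonal (fun i => l i ^ (n + 1)) * (Hᵀ * H) * diagonal l * Hᵀ := by
          rw [pow_succ, ih]; simp only [Matrix.mul_assoc]
      _ = H * diagonal (fun i => l i ^ (n + 1 + 1)) * Hᵀ := by
          rw [hH, Matrix.mul_one, Matrix.mul_assoc H, diagonal_mul_diagonal]
          simp only [← pow_succ]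

theorem trace_mul_diagonal_mul_transpose {r : ℕ} {H : Matrix (Fin p) (Fin r) ℝ} (hH : Hᵀ * H = 1)
    (l : Fin r → ℝ) : (H * diagonal l * Hᵀ).trace = ∑ i, l i := by
  rw [trace_mul_comm, ← Matrix.mul_assoc, hH, Matrix.one_mul, trace_diagonal]

theorem det_one_sub_smul_mul_diagonal_mul_transpose {r : ℕ} {H : Matrix (Fin p) (Fin r) ℝ}
    (hH : Hᵀ * H = 1) (l : Fin r → ℝ) (t : ℝ) :
    (1 - t • (H * diagonal l * Hᵀ)).det = ∏ i, (1 - t * l i) := by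
  rw [Matrix.mul_assoc, ← Matrix.mul_smul, det_one_sub_mul_comm, Matrix.smul_mul,
    Matrix.mul_assoc, hH, Matrix.mul_one, ← diagonal_smul, ← diagonal_one, diagonal_sub,
    det_diagonal]
  rfl

theorem IsEigenvectorMatrix.scatter_pow {u : Fin m → Fin p → ℝ}
    {H : Matrix (Fin p) (Fin (min p m)) ℝ} (hH : IsEigenvectorMatrix u H) (n : ℕ) :
    scatter u ^ (n + 1) = H * diagonal (fun i => eig u i ^ (n + 1)) * Hᵀ := by
  rw [hH.2, mul_diagonal_mul_transpose_pow hH.1]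

theorem trace_scatter_pow (u : Fin m → Fin p → ℝ) (n : ℕ) :
    (scatter u ^ (n + 1)).trace = ∑ i, eig u i ^ (n + 1) := by
  obtain ⟨H, hH⟩ := exists_isEigenvectorMatrix u
  rw [hH.scatter_pow, trace_mul_diagonal_mul_transpose hH.1]

theorem det_one_sub_smul_scatter (u : Fin m → Fin p → ℝ) (t : ℝ) :
    (1 - t • scatter u).det = ∏ i, (1 - t * eig u i) := by
  obtain ⟨H, hH⟩ := exists_isEigenvectorMatrix u
  rw [hH.2, det_one_sub_smul_mul_diagonal_mul_transpose hH.1]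

theorem eig_eq_of_det_eq_zero {u : Fin m → Fin p → ℝ} {l : Fin (min p m) → ℝ}
    (hl : l ∈ chamber (min p m)) (h : ∀ i, (1 - (l i)⁻¹ • scatter u).det = 0) : eig u = l := by
  have hex (i) : ∃ j, eig u j = l i := by
    obtain ⟨j, -, hj⟩ := Finset.prod_eq_zero_iff.mp
      ((det_one_sub_smul_scatter u _).symm.trans (h i))
    exact ⟨j, by rw [sub_eq_zero, eq_comm, inv_mul_eq_one₀ (hl.2 i).ne'] at hj; exact hj.symm⟩
  choose σ hσ using hex
  have hmono : StrictMono σ := fun i j hij => not_le.mp fun hle =>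
    (hl.1 hij).not_ge (by simpa only [hσ] using eig_antitone u hle)
  funext i
  rw [← hσ i, hmono.eq_id, id]

theorem eig_eq_of_scatter_eq {u : Fin m → Fin p → ℝ} {H : Matrix (Fin p) (Fin (min p m)) ℝ}
    {l : Fin (min p m) → ℝ} (hH : Hᵀ * H = 1) (hl : l ∈ chamber (min p m))
    (h : scatter u = H * diagonal l * Hᵀ) : eig u = l :=
  eig_eq_of_det_eq_zero hl fun i => by
    rw [h, det_one_sub_smul_mul_diagonal_mul_transpose hH]
    exact Finset.prod_eq_zero (Finset.mem_univ i) (by rw [inv_mul_cancel₀ (hl.2 i).ne', sub_self])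

end Eigenvalues

section Discriminant

variable {p m r : ℕ}

/-- The Hankel determinant of the power sums of the eigenvalues. It is a polynomial in `u`, equal to
the discriminant of the eigenvalues times their product, so it vanishes exactly where the
eigenvalues fail to be distinct and positive. -/
noncomputable def disc (u : Fin m → Fin p → ℝ) : ℝ :=
  (Matrix.of fun i j : Fin (min p m) => (scatter u ^ ((i : ℕ) + j + 1)).trace).det

theorem det_sum_pow (l : Fin r → ℝ) :
    (Matrix.of fun i j : Fin r => ∑ k, l k ^ ((i : ℕ) + j + 1)).det
      = (vandermonde l).det ^ 2 * ∏ k, l k := by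
  have hfactor : (Matrix.of fun i j : Fin r => ∑ k, l k ^ ((i : ℕ) + j + 1))
      = (vandermonde l)ᵀ * diagonal l * vandermonde l := by
    ext i j
    simp only [Matrix.of_apply, mul_apply (M := _ * _), mul_diagonal, transpose_apply,
      vandermonde_apply]
    exact Finset.sum_congr rfl fun k _ => by ring
  rw [hfactor, det_mul, det_mul, det_transpose, det_diagonal]
  ring

theorem disc_eq (u : Fin m → Fin p → ℝ) :
    disc u = (vandermonde (eig u)).det ^ 2 * ∏ k, eig u k := by
  simp only [disc, trace_scatter_pow, det_sum_pow]

theorem disc_nonneg (u : Fin m → Fin p → ℝ) : 0 ≤ disc u :=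
  disc_eq u ▸ mul_nonneg (sq_nonneg _) (Finset.prod_nonneg fun i _ => eig_nonneg u i)

theorem disc_ne_zero_iff {u : Fin m → Fin p → ℝ} : disc u ≠ 0 ↔ eig u ∈ chamber (min p m) := by
  rw [disc_eq, mul_ne_zero_iff, pow_ne_zero_iff two_ne_zero, det_vandermonde_ne_zero_iff,
    Finset.prod_ne_zero_iff]
  exact ⟨fun h => ⟨(eig_antitone u).strictAnti_of_injective h.1,
      fun i => (eig_nonneg u i).lt_of_ne' (h.2 i (Finset.mem_univ i))⟩,
    fun h => ⟨h.1.injective, fun i _ => (h.2 i).ne'⟩⟩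

theorem isOpen_chamber (r : ℕ) : IsOpen (chamber r) := by
  simp only [chamber, StrictAnti, Set.ofPred_and, Set.ofPred_forall]
  exact (isOpen_iInter_of_finite fun i => isOpen_iInter_of_finite fun j =>
    isOpen_iInter_of_finite fun _ => isOpen_lt (continuous_apply j) (continuous_apply i)).inter
    (isOpen_iInter_of_finite fun i => isOpen_lt continuous_const (continuous_apply i))

end Discriminant

section Differentiability

variable {X : Type*} [NormedAddCommGroup X] [NormedSpace ℝ X]

theorem contDiff_det {ι : Type*} [Fintype ι] [DecidableEq ι] {n : WithTop ℕ∞}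
    {M : X → Matrix ι ι ℝ} (hM : ∀ a b, ContDiff ℝ n fun x => M x a b) :
    ContDiff ℝ n fun x => (M x).det := by
  simp only [det_apply']
  exact ContDiff.sum fun σ _ => contDiff_const.mul (contDiff_prod fun i _ => hM _ _)

theorem exists_differentiableAt_root [CompleteSpace X] {F : X × ℝ → ℝ} {x : X} {y c : ℝ}
    (hF : ContDiff ℝ 1 F) (h0 : F (x, y) = 0) (hc : HasDerivAt (fun s => F (x, s)) c y)
    (hc0 : c ≠ 0) :
    ∃ ψ : X → ℝ, DifferentiableAt ℝ ψ x ∧ ψ x = y ∧ ∀ᶠ v in 𝓝 x, F (v, ψ v) = 0 := by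
  have hpartial : fderiv ℝ F (x, y) (0, 1) = c :=
    ((hF.differentiable one_ne_zero (x, y)).hasFDerivAt.comp_hasDerivAt y
      ((hasDerivAt_const y x).prodMk (hasDerivAt_id y))).unique hc
  have hinv : (fderiv ℝ F (x, y) ∘L .inr ℝ X ℝ).IsInvertible := by
    refine ⟨ContinuousLinearEquiv.unitsEquivAut ℝ (Units.mk0 c hc0), ?_⟩
    ext
    simp [ContinuousLinearEquiv.unitsEquivAut, hpartial]
  have hF' : ContDiffAt ℝ 1 F (x, y) := hF.contDiffAt
  exact ⟨hF'.implicitFunction one_ne_zero hinv,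
    (hF'.hasStrictFDerivAt_implicitFunction one_ne_zero hinv).hasFDerivAt.differentiableAt,
    hF'.implicitFunction_apply_self one_ne_zero hinv,
    h0 ▸ hF'.eventually_apply_implicitFunction one_ne_zero hinv⟩

variable {p m : ℕ}

theorem contDiff_scatter {n : WithTop ℕ∞} (a b : Fin p) :
    ContDiff ℝ n fun u : Fin m → Fin p → ℝ => scatter u a b := by
  simp only [scatter, mul_apply, transpose_apply, Matrix.of_apply]
  fun_prop

theorem contDiff_scatter_pow {n : WithTop ℕ∞} (k : ℕ) (a b : Fin p) :
    ContDiff ℝ n fun u : Fin m → Fin p → ℝ => (scatter u ^ k) a b := by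
  induction k generalizing a b with
  | zero => simpa only [pow_zero] using contDiff_const
  | succ k ih =>
    simp only [pow_succ, mul_apply]
    exact ContDiff.sum fun c _ => (ih a c).mul (contDiff_scatter c b)

theorem contDiff_disc {n : WithTop ℕ∞} : ContDiff ℝ n (disc : (Fin m → Fin p → ℝ) → ℝ) :=
  contDiff_det fun i j => by
    simp only [Matrix.of_apply, trace, diag]
    exact ContDiff.sum fun a _ => contDiff_scatter_pow _ a a

theorem isOpen_setOf_eig_mem_chamber :
    IsOpen {u : Fin m → Fin p → ℝ | eig u ∈ chamber (min p m)} := by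
  simp only [← disc_ne_zero_iff]
  exact isOpen_ne_fun (contDiff_disc (n := 0)).continuous continuous_const

theorem hasDerivAt_prod_one_sub_mul_inv {r : ℕ} {l : Fin r → ℝ} (hl : l ∈ chamber r) (j : Fin r) :
    HasDerivAt (fun t => ∏ i, (1 - t * l i))
      (-l j * ∏ i ∈ Finset.univ.erase j, (1 - (l j)⁻¹ * l i)) (l j)⁻¹ := by
  have hroot : 1 - (l j)⁻¹ * l j = 0 := by rw [inv_mul_cancel₀ (hl.2 j).ne', sub_self]
  have hlin : HasDerivAt (fun t => 1 - t * l j) (-l j) (l j)⁻¹ := by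
    simpa only [id, one_mul] using ((hasDerivAt_id (l j)⁻¹).mul_const (l j)).const_sub 1
  have hrest : DifferentiableAt ℝ (fun t => ∏ i ∈ Finset.univ.erase j, (1 - t * l i)) (l j)⁻¹ :=
    DifferentiableAt.fun_finsetProd fun i _ => by fun_prop
  simp only [← Finset.mul_prod_erase Finset.univ _ (Finset.mem_univ j)]
  simpa only [Pi.mul_def, hroot, zero_mul, add_zero] using hlin.mul hrest.hasDerivAt

theorem differentiableAt_eig {u : Fin m → Fin p → ℝ} (hu : eig u ∈ chamber (min p m)) :
    DifferentiableAt ℝ eig u := by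
  let F : (Fin m → Fin p → ℝ) × ℝ → ℝ := fun x => (1 - x.2 • scatter x.1).det
  have hF : ContDiff ℝ 1 F := contDiff_det fun a b =>
    contDiff_const.sub (contDiff_snd.mul ((contDiff_scatter a b).comp contDiff_fst))
  have hroot (j) : ∃ ψ : (Fin m → Fin p → ℝ) → ℝ, DifferentiableAt ℝ ψ u ∧ ψ u = (eig u j)⁻¹ ∧
      ∀ᶠ v in 𝓝 u, F (v, ψ v) = 0 := by
    have hinv (i) (h : (1 - (eig u j)⁻¹ * eig u i) = 0) : i = j := by
      rw [sub_eq_zero, eq_comm, inv_mul_eq_one₀ (hu.2 j).ne'] at h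
      exact hu.1.injective h.symm
    have hne : -eig u j * ∏ i ∈ Finset.univ.erase j, (1 - (eig u j)⁻¹ * eig u i) ≠ 0 :=
      mul_ne_zero (neg_ne_zero.mpr (hu.2 j).ne')
        (Finset.prod_ne_zero_iff.mpr fun i hi h => Finset.ne_of_mem_erase hi (hinv i h))
    refine exists_differentiableAt_root hF ?_ ?_ hne
    · refine (det_one_sub_smul_scatter u _).trans ?_
      exact Finset.prod_eq_zero (Finset.mem_univ j)
        (by rw [inv_mul_cancel₀ (hu.2 j).ne', sub_self])
    · simpa only [F, det_one_sub_smul_scatter] using hasDerivAt_prod_one_sub_mul_inv hu j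
  choose ψ hψ hψu hψF using hroot
  have hψ_inv (i) : DifferentiableAt ℝ (fun v => (ψ i v)⁻¹) u :=
    (hψ i).inv (hψu i ▸ inv_ne_zero (hu.2 i).ne')
  have hdiff : DifferentiableAt ℝ (fun v i => (ψ i v)⁻¹) u := differentiableAt_pi.mpr hψ_inv
  refine hdiff.congr_of_eventuallyEq ?_
  have hmem : ∀ᶠ v in 𝓝 u, (fun i => (ψ i v)⁻¹) ∈ chamber (min p m) := by
    refine hdiff.continuousAt.eventually_mem ((isOpen_chamber _).mem_nhds ?_)
    simpa only [hψu, inv_inv] using hu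
  filter_upwards [hmem, eventually_all.mpr hψF] with v hv hvF
  exact eig_eq_of_det_eq_zero hv fun i => by simpa only [inv_inv] using hvF i

end Differentiability

section MatrixCalculus

variable {ι κ μ : Type*}

theorem hasDerivAt_matrix_iff [Finite κ] {A : ℝ → Matrix ι κ ℝ} {A' : Matrix ι κ ℝ} {t : ℝ} :
    HasDerivAt A A' t ↔ ∀ i j, HasDerivAt (fun s => A s i j) (A' i j) t := by
  cases nonempty_fintype κ
  exact hasDerivAt_pi.trans (forall_congr' fun _ => hasDerivAt_pi)

variable [Fintype κ]

theorem hasDerivAt_matrix_mul [Finite μ] {A : ℝ → Matrix ι κ ℝ} {B : ℝ → Matrix κ μ ℝ}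
    {A' : Matrix ι κ ℝ} {B' : Matrix κ μ ℝ} {t : ℝ} (hA : HasDerivAt A A' t)
    (hB : HasDerivAt B B' t) :
    HasDerivAt (fun s => A s * B s) (A' * B t + A t * B') t := by
  rw [hasDerivAt_matrix_iff] at *
  intro i j
  simp only [Matrix.add_apply, mul_apply, ← Finset.sum_add_distrib]
  exact HasDerivAt.fun_sum fun k _ => (hA i k).mul (hB k j)

theorem hasDerivAt_matrix_pow [DecidableEq κ] {A : ℝ → Matrix κ κ ℝ} {A' : Matrix κ κ ℝ} {t : ℝ}
    (hA : HasDerivAt A A' t) (n : ℕ) :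
    HasDerivAt (fun s => A s ^ n) (∑ j ∈ Finset.range n, A t ^ j * A' * A t ^ (n - 1 - j)) t := by
  induction n with
  | zero =>
    simp only [pow_zero, Finset.range_zero, Finset.sum_empty]
    exact hasDerivAt_matrix_iff.mpr fun _ _ => hasDerivAt_const _ _
  | succ n ih =>
    simp only [pow_succ (A _) n]
    convert hasDerivAt_matrix_mul ih hA using 1
    rw [Finset.sum_range_succ, Finset.sum_mul]
    congr 1
    · refine Finset.sum_congr rfl fun j hj => ?_
      rw [Matrix.mul_assoc _ (A t ^ _), ← pow_succ]
      congr 2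
      have := Finset.mem_range.mp hj
      omega
    · simp only [Nat.add_sub_cancel, Nat.sub_self, pow_zero, Matrix.mul_one]

theorem sum_mul_single_mul_apply [Fintype ι] [DecidableEq ι] [DecidableEq κ] (B : Matrix ι ι ℝ)
    (C : Matrix κ κ ℝ) :
    ∑ a : ι, ∑ b : κ, (B * single a b (1 : ℝ) * C) a b = B.trace * C.trace := by
  rw [trace, trace, Finset.sum_mul_sum]
  refine Finset.sum_congr rfl fun a _ => Finset.sum_congr rfl fun b _ => ?_
  simp [mul_apply, single_apply, ite_and]

theorem sum_mul_transpose_single_mul_apply [Fintype ι] [DecidableEq ι] [DecidableEq κ]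
    (B C : Matrix ι κ ℝ) :
    ∑ a : ι, ∑ b : κ, (B * (single a b (1 : ℝ))ᵀ * C) a b = (Bᵀ * C).trace := by
  rw [Finset.sum_comm, trace]
  refine Finset.sum_congr rfl fun b _ => ?_
  rw [diag_apply, mul_apply]
  refine Finset.sum_congr rfl fun a _ => ?_
  simp [mul_apply, single_apply, ite_and]

theorem trace_eq_sum_single [Fintype ι] [DecidableEq ι] [DecidableEq κ]
    (T : (ι → κ → ℝ) →ₗ[ℝ] (ι → κ → ℝ)) :
    LinearMap.trace ℝ _ T = ∑ a, ∑ b, T (single a b (1 : ℝ)) a b := by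
  rw [LinearMap.trace_eq_matrix_trace ℝ (Pi.basis fun _ => Pi.basisFun ℝ κ), trace,
    Fintype.sum_sigma]
  refine Finset.sum_congr rfl fun a _ => Finset.sum_congr rfl fun b _ => ?_
  rw [diag_apply, LinearMap.toMatrix_apply, Pi.basis_repr, Pi.basisFun_repr, Pi.basis_apply,
    Pi.basisFun_apply, single_eq_of_single_single]
  rfl

end MatrixCalculus

section Divergence

variable {X : Type*} [NormedAddCommGroup X] [NormedSpace ℝ X]

/-- The divergence of a vector field, as the trace of its derivative; it does not depend on a choice
of coordinates, and it is `0` where the field is not differentiable. -/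
noncomputable def divergence (V : X → X) (x : X) : ℝ :=
  LinearMap.trace ℝ X (fderiv ℝ V x)

theorem divergence_sum {ι : Type*} {s : Finset ι} {V : ι → X → X} {x : X}
    (hV : ∀ i ∈ s, DifferentiableAt ℝ (V i) x) :
    divergence (fun y => ∑ i ∈ s, V i y) x = ∑ i ∈ s, divergence (V i) x := by
  simp only [divergence, fderiv_fun_sum hV, ContinuousLinearMap.toLinearMap_sum, map_sum]

theorem divergence_smul [FiniteDimensional ℝ X] {c : X → ℝ} {V : X → X} {x : X}
    (hc : DifferentiableAt ℝ c x) (hV : DifferentiableAt ℝ V x) :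
    divergence (fun y => c y • V y) x = c x * divergence V x + fderiv ℝ c x (V x) := by
  rw [divergence, fderiv_fun_smul hc hV, ContinuousLinearMap.toLinearMap_add, map_add,
    ContinuousLinearMap.toLinearMap_smul, map_smul, smul_eq_mul]
  congr 1
  exact LinearMap.trace_smulRight (fderiv ℝ c x : X →ₗ[ℝ] ℝ) (V x)

theorem fderiv_eq_of_hasLineDerivAt {Y : Type*} [NormedAddCommGroup Y] [NormedSpace ℝ Y]
    {f : X → Y} {x v : X} {f' : Y} (hf : DifferentiableAt ℝ f x) (h : HasLineDerivAt ℝ f f' x v) :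
    fderiv ℝ f x v = f' :=
  (hf.hasFDerivAt.hasLineDerivAt v).unique h

end Divergence

section PowerField

variable {p m : ℕ}

/-- The vector field `u ↦ u Sᵏ`, where `S = uᵀ u`. -/
def powerField (k : ℕ) (u : Fin m → Fin p → ℝ) : Fin m → Fin p → ℝ :=
  Matrix.of.symm (Matrix.of u * scatter u ^ k)

theorem contDiff_powerField {n : WithTop ℕ∞} (k : ℕ) :
    ContDiff ℝ n (powerField k : (Fin m → Fin p → ℝ) → _) := by
  refine contDiff_pi.mpr fun a => contDiff_pi.mpr fun b => ?_
  simp only [powerField, of_symm_apply, mul_apply, Matrix.of_apply]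
  exact ContDiff.sum fun c _ => (contDiff_apply_apply ℝ ℝ a c).mul (contDiff_scatter_pow k c b)

theorem hasDerivAt_of_add_smul (u W : Fin m → Fin p → ℝ) (t : ℝ) :
    HasDerivAt (fun t : ℝ => Matrix.of (u + t • W)) (Matrix.of W) t :=
  hasDerivAt_matrix_iff.mpr fun a b => by
    simpa using ((hasDerivAt_id t).mul_const (W a b)).const_add (u a b)

theorem hasDerivAt_scatter_add_smul (u W : Fin m → Fin p → ℝ) :
    HasDerivAt (fun t : ℝ => scatter (u + t • W))
      ((Matrix.of W)ᵀ * Matrix.of u + (Matrix.of u)ᵀ * Matrix.of W) 0 := by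
  have hline := hasDerivAt_of_add_smul u W 0
  have hlineT : HasDerivAt (fun t : ℝ => (Matrix.of (u + t • W))ᵀ) (Matrix.of W)ᵀ 0 :=
    hasDerivAt_matrix_iff.mpr fun a b => hasDerivAt_matrix_iff.mp hline b a
  simpa only [scatter, zero_smul, add_zero] using hasDerivAt_matrix_mul hlineT hline

theorem hasLineDerivAt_powerField (n : ℕ) (u W : Fin m → Fin p → ℝ) :
    HasLineDerivAt ℝ (powerField (n + 1)) (Matrix.of.symm (Matrix.of W * scatter u ^ (n + 1)
      + Matrix.of u * ∑ j ∈ Finset.range (n + 1), scatter u ^ j *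
        ((Matrix.of W)ᵀ * Matrix.of u + (Matrix.of u)ᵀ * Matrix.of W) * scatter u ^ (n - j)))
      u W := by
  have h := hasDerivAt_matrix_mul (hasDerivAt_of_add_smul u W 0)
    (hasDerivAt_matrix_pow (hasDerivAt_scatter_add_smul u W) (n + 1))
  simp only [zero_smul, add_zero, Nat.add_sub_cancel] at h
  exact h

theorem transpose_scatter_pow (u : Fin m → Fin p → ℝ) (j : ℕ) :
    (scatter u ^ j)ᵀ = scatter u ^ j :=
  conjTranspose_eq_transpose_of_trivial (scatter u ^ j) ▸ (scatter_isHermitian u).pow j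

theorem divergence_powerField (n : ℕ) (u : Fin m → Fin p → ℝ) :
    divergence (powerField (n + 1)) u = m * (scatter u ^ (n + 1)).trace
      + ∑ j ∈ Finset.range (n + 1), ((scatter u ^ (n + 1)).trace
        + (scatter u ^ (j + 1)).trace * (scatter u ^ (n - j)).trace) := by
  have hderiv (W : Matrix (Fin m) (Fin p) ℝ) : fderiv ℝ (powerField (n + 1)) u W
      = Matrix.of.symm ((1 : Matrix (Fin m) (Fin m) ℝ) * W * scatter u ^ (n + 1)
        + ∑ j ∈ Finset.range (n + 1),
          (Matrix.of u * scatter u ^ j * Wᵀ * (Matrix.of u * scatter u ^ (n - j))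
            + Matrix.of u * scatter u ^ j * (Matrix.of u)ᵀ * W * scatter u ^ (n - j))) := by
    rw [fderiv_eq_of_hasLineDerivAt ((contDiff_powerField _).differentiable one_ne_zero u)
      (hasLineDerivAt_powerField n u W)]
    simp only [Matrix.mul_add, Matrix.add_mul, Matrix.mul_sum, Matrix.mul_assoc, Matrix.one_mul]
    rfl
  have htrace₁ (j) (hj : j ∈ Finset.range (n + 1)) :
      ((Matrix.of u * scatter u ^ j)ᵀ * (Matrix.of u * scatter u ^ (n - j))).trace
        = (scatter u ^ (n + 1)).trace := by
    rw [transpose_mul, transpose_scatter_pow, Matrix.mul_assoc, ← Matrix.mul_assoc _ᵀ, ← scatter,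
      ← pow_succ', ← pow_add, show j + (n - j + 1) = n + 1 by grind]
  have htrace₂ (j : ℕ) : (Matrix.of u * scatter u ^ j * (Matrix.of u)ᵀ).trace
      = (scatter u ^ (j + 1)).trace := by
    rw [trace_mul_cycle, ← scatter, ← pow_succ']
  simp only [divergence, trace_eq_sum_single, ContinuousLinearMap.coe_coe, hderiv]
  simp only [of_symm_apply, Matrix.add_apply, Matrix.sum_apply, Finset.sum_add_distrib,
    sum_mul_single_mul_apply, trace_one, Fintype.card_fin]
  congr 1
  simp only [Finset.sum_comm (s := (Finset.univ : Finset (Fin p))),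
    Finset.sum_comm (s := (Finset.univ : Finset (Fin m))) (t := Finset.range _)]
  simp only [sum_mul_transpose_single_mul_apply, sum_mul_single_mul_apply, htrace₂]
  rw [Finset.sum_congr rfl htrace₁]

end PowerField

section SteinHaff

variable {p m : ℕ}

/-- The Stein–Haff expression
`∑ᵢ ((v - r + 1) φᵢ + 2 lᵢ ∂φᵢ/∂lᵢ + ∑_{j ≠ i} (lᵢφᵢ - lⱼφⱼ)/(lᵢ - lⱼ))` at `l`, where
`r = min p m` and `v = max p m`. -/
noncomputable def steinHaff (p m : ℕ) (φ : Fin (min p m) → (Fin (min p m) → ℝ) → ℝ)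
    (l : Fin (min p m) → ℝ) : ℝ :=
  ∑ i, ((((max p m : ℕ) : ℝ) - ((min p m : ℕ) : ℝ) + 1) * φ i l
    + 2 * l i * partialDeriv (φ i) i l
    + ∑ j ∈ Finset.univ.erase i, (l i * φ i l - l j * φ j l) / (l i - l j))

theorem steinHaff_congr {φ ψ : Fin (min p m) → (Fin (min p m) → ℝ) → ℝ}
    {l : Fin (min p m) → ℝ} (h : ∀ i, φ i =ᶠ[𝓝 l] ψ i) : steinHaff p m φ l = steinHaff p m ψ l := by
  simp only [steinHaff, partialDeriv, (h _).eq_of_nhds, (h _).fderiv_eq]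

theorem steinHaff_sum {ι : Type*} {s : Finset ι}
    {φ : ι → Fin (min p m) → (Fin (min p m) → ℝ) → ℝ} {l : Fin (min p m) → ℝ}
    (hφ : ∀ k ∈ s, ∀ i, DifferentiableAt ℝ (φ k i) l) :
    steinHaff p m (fun i y => ∑ k ∈ s, φ k i y) l = ∑ k ∈ s, steinHaff p m (φ k) l := by
  have hpartial (i) : partialDeriv (fun y => ∑ k ∈ s, φ k i y) i l
      = ∑ k ∈ s, partialDeriv (φ k i) i l := by
    simp only [partialDeriv, fderiv_fun_sum fun k hk => hφ k hk i, _root_.sum_apply]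
  simp only [steinHaff, hpartial, Finset.mul_sum, ← Finset.sum_sub_distrib, Finset.sum_div]
  rw [Finset.sum_comm (s := s)]
  refine Finset.sum_congr rfl fun i _ => ?_
  rw [Finset.sum_comm (s := Finset.univ.erase i), ← Finset.sum_add_distrib,
    ← Finset.sum_add_distrib]

theorem steinHaff_mul {c : (Fin (min p m) → ℝ) → ℝ}
    {φ : Fin (min p m) → (Fin (min p m) → ℝ) → ℝ} {l : Fin (min p m) → ℝ}
    (hc : DifferentiableAt ℝ c l) (hφ : ∀ i, DifferentiableAt ℝ (φ i) l) :
    steinHaff p m (fun i y => c y * φ i y) l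
      = c l * steinHaff p m φ l + ∑ i, 2 * l i * φ i l * partialDeriv c i l := by
  have hpartial (i) : partialDeriv (fun y => c y * φ i y) i l
      = c l * partialDeriv (φ i) i l + φ i l * partialDeriv c i l := by
    simp only [partialDeriv, fderiv_fun_mul hc (hφ i), _root_.add_apply,
      _root_.smul_apply, smul_eq_mul]
  have hquot (i j) : (l i * (c l * φ i l) - l j * (c l * φ j l)) / (l i - l j)
      = c l * ((l i * φ i l - l j * φ j l) / (l i - l j)) := by ring
  simp only [steinHaff, hpartial, hquot, ← Finset.mul_sum]
  rw [Finset.mul_sum, ← Finset.sum_add_distrib]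
  exact Finset.sum_congr rfl fun i _ => by ring

theorem partialDeriv_pow {r : ℕ} (i : Fin r) (k : ℕ) (l : Fin r → ℝ) :
    partialDeriv (fun y => y i ^ (k + 1)) i l = (k + 1) * l i ^ k := by
  have h := ((hasFDerivAt_apply (𝕜 := ℝ) i l).pow (k + 1)).fderiv
  rw [partialDeriv, h]
  simp

theorem sum_pow_mul_pow_eq_div {x y : ℝ} (hxy : x ≠ y) (n : ℕ) :
    ∑ j ∈ Finset.range n, x ^ (j + 1) * y ^ (n - j)
      = (x * x ^ (n + 1) - y * y ^ (n + 1)) / (x - y) - (x ^ (n + 1) + y ^ (n + 1)) := by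
  have h := (Commute.all x y).geom_sum₂ hxy (n + 2)
  have hterm (j : ℕ) : x ^ (j + 1) * y ^ (n + 2 - 1 - (j + 1)) = x ^ (j + 1) * y ^ (n - j) := by
    congr 2; omega
  rw [Finset.sum_range_succ', Finset.sum_range_succ] at h
  simp only [hterm, Nat.sub_self, pow_zero, mul_one, one_mul, Nat.sub_zero] at h
  rw [← pow_succ', ← pow_succ', ← h, show n + 2 - 1 = n + 1 from rfl]
  ring

theorem sum_mul_sum_pow {r : ℕ} {l : Fin r → ℝ} (hl : Function.Injective l) (n : ℕ) :
    ∑ j ∈ Finset.range n, (∑ i, l i ^ (j + 1)) * ∑ i, l i ^ (n - j)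
      = ∑ i, ((n - 2 * (r - 1)) * l i ^ (n + 1) + ∑ i' ∈ Finset.univ.erase i,
          (l i * l i ^ (n + 1) - l i' * l i' ^ (n + 1)) / (l i - l i')) := by
  have hdiag (i) : ∑ j ∈ Finset.range n, l i ^ (j + 1) * l i ^ (n - j) = n * l i ^ (n + 1) := by
    rw [Finset.sum_congr rfl fun j hj => ?_, Finset.sum_const, Finset.card_range, nsmul_eq_mul]
    rw [← pow_add]
    have := Finset.mem_range.mp hj
    congr 1; omega
  have hoff (i) : ∑ i' ∈ Finset.univ.erase i, ∑ j ∈ Finset.range n, l i ^ (j + 1) * l i' ^ (n - j)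
      = (∑ i' ∈ Finset.univ.erase i,
          (l i * l i ^ (n + 1) - l i' * l i' ^ (n + 1)) / (l i - l i'))
        - ((r - 2) * l i ^ (n + 1) + ∑ i', l i' ^ (n + 1)) := by
    rw [Finset.sum_congr rfl fun i' hi' => sum_pow_mul_pow_eq_div
      (hl.ne (Finset.ne_of_mem_erase hi').symm) n]
    simp only [Finset.sum_sub_distrib, Finset.sum_add_distrib]
    rw [Finset.sum_erase_eq_sub (f := fun _ => l i ^ (n + 1)) (Finset.mem_univ i),
      Finset.sum_erase_eq_sub (f := fun i' => l i' ^ (n + 1)) (Finset.mem_univ i),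
      Finset.sum_const, Finset.card_fin, nsmul_eq_mul]
    ring
  have hrow (i) : ∑ i', ∑ j ∈ Finset.range n, l i ^ (j + 1) * l i' ^ (n - j) =
      (n - (r - 2)) * l i ^ (n + 1) - ∑ i', l i' ^ (n + 1) + ∑ i' ∈ Finset.univ.erase i,
          (l i * l i ^ (n + 1) - l i' * l i' ^ (n + 1)) / (l i - l i') := by
    rw [← Finset.add_sum_erase _ _ (Finset.mem_univ i), hdiag, hoff]
    ring
  calc ∑ j ∈ Finset.range n, (∑ i, l i ^ (j + 1)) * ∑ i, l i ^ (n - j)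
      = ∑ i, ∑ i', ∑ j ∈ Finset.range n, l i ^ (j + 1) * l i' ^ (n - j) := by
        simp only [Finset.sum_mul_sum]
        rw [Finset.sum_comm]
        exact Finset.sum_congr rfl fun i _ => Finset.sum_comm
    _ = _ := by
        simp only [hrow, Finset.sum_add_distrib, Finset.sum_sub_distrib, ← Finset.mul_sum,
          Finset.sum_const, Finset.card_fin, nsmul_eq_mul]
        ring

theorem divergence_powerField_eq_steinHaff {u : Fin m → Fin p → ℝ}
    (hu : eig u ∈ chamber (min p m)) (n : ℕ) :
    divergence (powerField (n + 1)) u = steinHaff p m (fun i l => l i ^ (n + 1)) (eig u) := by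
  have hmaxmin : ((max p m : ℕ) : ℝ) + ((min p m : ℕ) : ℝ) = p + m := by
    exact_mod_cast max_add_min p m
  have hpow (j) (hj : j ∈ Finset.range n) :
      (scatter u ^ (j + 1)).trace * (scatter u ^ (n - j)).trace
      = (∑ i, eig u i ^ (j + 1)) * ∑ i, eig u i ^ (n - j) := by
    have := Finset.mem_range.mp hj
    rw [trace_scatter_pow, show n - j = n - j - 1 + 1 by omega, trace_scatter_pow]
  rw [divergence_powerField, Finset.sum_add_distrib, Finset.sum_range_succ (fun j => _ * _),
    Finset.sum_congr rfl hpow, sum_mul_sum_pow hu.1.injective]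
  simp only [steinHaff, partialDeriv_pow, trace_scatter_pow, Nat.sub_self, pow_zero, trace_one,
    Fintype.card_fin, Finset.sum_const, Finset.card_range, nsmul_eq_mul, Finset.sum_add_distrib,
    ← Finset.mul_sum]
  have hterm (i) : 2 * eig u i * ((n + 1) * eig u i ^ n)
      = 2 * (n + 1) * eig u i ^ (n + 1) := by ring
  simp only [hterm, ← Finset.mul_sum]
  simp only [Nat.cast_add, Nat.cast_one]
  linear_combination -(∑ i, eig u i ^ (n + 1)) * hmaxmin

end SteinHaff

section Interpolation

variable {r : ℕ}

/-- The matrix whose columns are `(lⱼ, lⱼ², …, lⱼʳ)`. -/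
def powerMatrix (l : Fin r → ℝ) : Matrix (Fin r) (Fin r) ℝ :=
  Matrix.of fun n j => l j ^ ((n : ℕ) + 1)

/-- The coefficients `c₁, …, c_r` of the polynomial `∑ₙ cₙ xⁿ` of degree at most `r` which vanishes
at `0` and takes the value `φⱼ(l)` at each `lⱼ`. -/
noncomputable def interpCoeff (φ : Fin r → (Fin r → ℝ) → ℝ) (n : Fin r) (l : Fin r → ℝ) : ℝ :=
  ((fun i => φ i l) ᵥ* (powerMatrix l)⁻¹) n

theorem det_powerMatrix_ne_zero {l : Fin r → ℝ} (hl : l ∈ chamber r) : (powerMatrix l).det ≠ 0 := by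
  have hfactor : powerMatrix l = (vandermonde l)ᵀ * diagonal l := by
    ext n j
    rw [powerMatrix, of_apply, mul_diagonal, transpose_apply, vandermonde_apply, pow_succ]
  rw [hfactor, det_mul, det_transpose, det_diagonal]
  exact mul_ne_zero (det_vandermonde_ne_zero_iff.mpr hl.1.injective)
    (Finset.prod_ne_zero_iff.mpr fun i _ => (hl.2 i).ne')

theorem sum_interpCoeff_mul_pow (φ : Fin r → (Fin r → ℝ) → ℝ) {l : Fin r → ℝ} (hl : l ∈ chamber r)
    (j : Fin r) : ∑ n, interpCoeff φ n l * l j ^ ((n : ℕ) + 1) = φ j l := by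
  have h : ((fun i => φ i l) ᵥ* (powerMatrix l)⁻¹) ᵥ* powerMatrix l = fun i => φ i l := by
    rw [vecMul_vecMul, nonsing_inv_mul _ (det_powerMatrix_ne_zero hl).isUnit, vecMul_one]
  exact congrFun h j

theorem differentiableAt_interpCoeff {φ : Fin r → (Fin r → ℝ) → ℝ} {l : Fin r → ℝ}
    (hφ : ∀ i, DifferentiableAt ℝ (φ i) l) (hl : l ∈ chamber r) (n : Fin r) :
    DifferentiableAt ℝ (interpCoeff φ n) l := by
  have hentry (i j) : ContDiff ℝ 1 fun y : Fin r → ℝ => powerMatrix y i j :=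
    (contDiff_apply ℝ ℝ j).pow _
  have hdet : DifferentiableAt ℝ (fun y : Fin r → ℝ => (powerMatrix y).det) l :=
    (contDiff_det hentry).differentiable one_ne_zero l
  have hadj (i) : DifferentiableAt ℝ (fun y : Fin r → ℝ => (powerMatrix y).adjugate i n) l := by
    simp only [adjugate_apply]
    refine (contDiff_det fun a b => ?_).differentiable one_ne_zero l
    by_cases h : a = n
    · simpa only [h, updateRow_self] using contDiff_const
    · simpa only [updateRow_ne h] using hentry a b
  have hcoeff (y : Fin r → ℝ) : interpCoeff φ n y
      = ∑ i, φ i y * ((powerMatrix y).det⁻¹ * (powerMatrix y).adjugate i n) := by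
    simp only [interpCoeff, vecMul, dotProduct, inv_def, Ring.inverse_eq_inv', Matrix.smul_apply,
      smul_eq_mul]
  simp only [funext hcoeff]
  exact DifferentiableAt.fun_sum fun i _ =>
    (hφ i).mul ((hdet.inv (det_powerMatrix_ne_zero hl)).mul (hadj i))

end Interpolation

section SpectralField

variable {p m : ℕ}

theorem scatter_add_smul_mul_diagonal {u : Fin m → Fin p → ℝ} {H : Matrix (Fin p) (Fin (min p m)) ℝ}
    (hH : IsEigenvectorMatrix u H) (d : Fin (min p m) → ℝ) (t : ℝ) :
    scatter (u + t • Matrix.of.symm (Matrix.of u * (H * diagonal d * Hᵀ)))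
      = H * diagonal (fun i => eig u i * (1 + t * d i) ^ 2) * Hᵀ := by
  set P := H * diagonal d * Hᵀ
  have hfactor : Matrix.of (u + t • Matrix.of.symm (Matrix.of u * P))
      = Matrix.of u * (1 + t • P) := by
    rw [Matrix.mul_add, Matrix.mul_one, Matrix.mul_smul]
    rfl
  have hPH : (1 + t • P) * H = H * diagonal (fun i => 1 + t * d i) := by
    have hdiag : diagonal (fun i => 1 + t * d i) = 1 + t • diagonal d := by
      rw [← diagonal_one, ← diagonal_smul, diagonal_add]
      rfl
    rw [hdiag, Matrix.add_mul, Matrix.smul_mul, Matrix.mul_assoc, hH.1, Matrix.mul_add,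
      Matrix.mul_smul, Matrix.one_mul, Matrix.mul_one, Matrix.mul_one]
  have hsymm : (1 + t • P)ᵀ = 1 + t • P := by
    simp only [P, transpose_add, transpose_one, transpose_smul, transpose_mul, transpose_transpose,
      diagonal_transpose, Matrix.mul_assoc]
  calc scatter (u + t • Matrix.of.symm (Matrix.of u * P))
      = (1 + t • P)ᵀ * scatter u * (1 + t • P) := by
        rw [scatter, hfactor, transpose_mul, scatter]
        simp only [Matrix.mul_assoc]
    _ = (1 + t • P) * H * diagonal (eig u) * ((1 + t • P) * H)ᵀ := by
        rw [transpose_mul, hsymm, hH.2]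
        simp only [Matrix.mul_assoc]
    _ = H * diagonal (fun i => eig u i * (1 + t * d i) ^ 2) * Hᵀ := by
        rw [hPH, transpose_mul, diagonal_transpose, Matrix.mul_assoc H, diagonal_mul_diagonal,
          Matrix.mul_assoc, ← Matrix.mul_assoc (diagonal _), diagonal_mul_diagonal,
          ← Matrix.mul_assoc]
        congr 3
        ext i
        ring

theorem fderiv_eig_apply {u : Fin m → Fin p → ℝ} (hu : eig u ∈ chamber (min p m))
    {H : Matrix (Fin p) (Fin (min p m)) ℝ} (hH : IsEigenvectorMatrix u H) (d : Fin (min p m) → ℝ) :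
    fderiv ℝ eig u (Matrix.of.symm (Matrix.of u * (H * diagonal d * Hᵀ)))
      = fun i => 2 * eig u i * d i := by
  let l : ℝ → Fin (min p m) → ℝ := fun t i => eig u i * (1 + t * d i) ^ 2
  have hscatter (t : ℝ) : scatter (u + t • Matrix.of.symm (Matrix.of u * (H * diagonal d * Hᵀ)))
      = H * diagonal (l t) * Hᵀ := scatter_add_smul_mul_diagonal hH d t
  have hl : HasDerivAt l (fun i => 2 * eig u i * d i) 0 := hasDerivAt_pi.mpr fun i => by
    have h := ((((hasDerivAt_id (0 : ℝ)).mul_const (d i)).const_add 1).fun_pow 2).const_mul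
      (eig u i)
    simp only [id, zero_mul, add_zero, one_pow, mul_one, one_mul, Nat.cast_ofNat,
      Nat.add_one_sub_one] at h
    exact h.congr_deriv (by ring)
  have hl0 : l 0 = eig u := by simp [l]
  refine fderiv_eq_of_hasLineDerivAt (differentiableAt_eig hu) (hl.congr_of_eventuallyEq ?_)
  have hmem : ∀ᶠ t in 𝓝 0, l t ∈ chamber (min p m) :=
    hl.continuousAt.eventually_mem ((isOpen_chamber _).mem_nhds (hl0 ▸ hu))
  filter_upwards [hmem] with t ht using eig_eq_of_scatter_eq hH.1 ht (hscatter t)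

theorem fderiv_apply_eq_sum_partialDeriv {r : ℕ} (c : (Fin r → ℝ) → ℝ) (l v : Fin r → ℝ) :
    fderiv ℝ c l v = ∑ i, v i * partialDeriv c i l := by
  nth_rw 1 [pi_eq_sum_univ' v]
  simp only [map_sum, map_smul, smul_eq_mul, partialDeriv]

theorem powerField_eq {u : Fin m → Fin p → ℝ} {H : Matrix (Fin p) (Fin (min p m)) ℝ}
    (hH : IsEigenvectorMatrix u H) (n : ℕ) : powerField (n + 1) u
      = Matrix.of.symm (Matrix.of u * (H * diagonal (fun i => eig u i ^ (n + 1)) * Hᵀ)) := by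
  rw [powerField, hH.scatter_pow]

theorem divergence_smul_powerField {u : Fin m → Fin p → ℝ} (hu : eig u ∈ chamber (min p m))
    {c : (Fin (min p m) → ℝ) → ℝ} (hc : DifferentiableAt ℝ c (eig u)) (n : ℕ) :
    divergence (fun v => c (eig v) • powerField (n + 1) v) u
      = steinHaff p m (fun i l => c l * l i ^ (n + 1)) (eig u) := by
  obtain ⟨H, hH⟩ := exists_isEigenvectorMatrix u
  have hcomp : fderiv ℝ (fun v => c (eig v)) u (powerField (n + 1) u)
      = ∑ i, 2 * eig u i * eig u i ^ (n + 1) * partialDeriv c i (eig u) := by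
    rw [fderiv_fun_comp u hc (differentiableAt_eig hu), ContinuousLinearMap.comp_apply,
      powerField_eq hH, fderiv_eig_apply hu hH, fderiv_apply_eq_sum_partialDeriv]
  rw [divergence_smul (c := fun v => c (eig v)) (hc.comp u (differentiableAt_eig hu))
      ((contDiff_powerField _).differentiable one_ne_zero u), hcomp,
    divergence_powerField_eq_steinHaff hu, steinHaff_mul hc fun i => by fun_prop]

/-- The vector field `u ↦ u H Φ(L) Hᵀ`, where `uᵀ u = H L Hᵀ`. Writing it as a combination of the
fields `u Sⁿ` avoids differentiating the eigenvectors. -/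
noncomputable def spectralField (φ : Fin (min p m) → (Fin (min p m) → ℝ) → ℝ)
    (u : Fin m → Fin p → ℝ) : Fin m → Fin p → ℝ :=
  ∑ n, interpCoeff φ n (eig u) • powerField ((n : ℕ) + 1) u

variable {φ : Fin (min p m) → (Fin (min p m) → ℝ) → ℝ} {u : Fin m → Fin p → ℝ}

theorem spectralField_eq (φ : Fin (min p m) → (Fin (min p m) → ℝ) → ℝ)
    (hu : eig u ∈ chamber (min p m)) {H : Matrix (Fin p) (Fin (min p m)) ℝ}
    (hH : IsEigenvectorMatrix u H) : spectralField φ u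
      = Matrix.of.symm (Matrix.of u * (H * diagonal (fun i => φ i (eig u)) * Hᵀ)) := by
  have hdiag : diagonal (fun i => φ i (eig u))
      = ∑ n, interpCoeff φ n (eig u) • diagonal (fun i => eig u i ^ ((n : ℕ) + 1)) := by
    simp only [← diagonal_smul, ← sum_interpCoeff_mul_pow φ hu]
    ext i j
    rw [Matrix.sum_apply]
    rcases eq_or_ne i j with rfl | hij
    · simp only [diagonal_apply_eq, Pi.smul_apply, smul_eq_mul]
    · simp only [diagonal_apply_ne _ hij, Finset.sum_const_zero]
  simp only [spectralField, powerField_eq hH, hdiag, Matrix.mul_sum, Matrix.sum_mul,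
    Matrix.mul_smul, Matrix.smul_mul]
  rfl

theorem fderiv_eig_spectralField (φ : Fin (min p m) → (Fin (min p m) → ℝ) → ℝ)
    (hu : eig u ∈ chamber (min p m)) :
    fderiv ℝ eig u (spectralField φ u) = fun i => 2 * eig u i * φ i (eig u) := by
  obtain ⟨H, hH⟩ := exists_isEigenvectorMatrix u
  rw [spectralField_eq φ hu hH, fderiv_eig_apply hu hH]

theorem differentiableAt_spectralField (hu : eig u ∈ chamber (min p m))
    (hφ : ∀ i, DifferentiableAt ℝ (φ i) (eig u)) : DifferentiableAt ℝ (spectralField φ) u :=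
  DifferentiableAt.fun_sum fun n _ =>
    ((differentiableAt_interpCoeff hφ hu n).comp u (differentiableAt_eig hu)).smul
      ((contDiff_powerField _).differentiable one_ne_zero u)

theorem divergence_spectralField (hu : eig u ∈ chamber (min p m))
    (hφ : ∀ i, DifferentiableAt ℝ (φ i) (eig u)) :
    divergence (spectralField φ) u = steinHaff p m φ (eig u) := by
  have hcoeff (n) := differentiableAt_interpCoeff hφ hu n
  calc divergence (spectralField φ) u
      = ∑ n, divergence (fun v => interpCoeff φ n (eig v) • powerField ((n : ℕ) + 1) v) u :=
        divergence_sum fun n _ => ((hcoeff n).comp u (differentiableAt_eig hu)).smul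
          ((contDiff_powerField _).differentiable one_ne_zero u)
    _ = ∑ n : Fin (min p m),
          steinHaff p m (fun i l => interpCoeff φ n l * l i ^ ((n : ℕ) + 1)) (eig u) :=
        Finset.sum_congr rfl fun n _ => divergence_smul_powerField hu (hcoeff n) n
    _ = steinHaff p m (fun i l => ∑ n, interpCoeff φ n l * l i ^ ((n : ℕ) + 1)) (eig u) :=
        (steinHaff_sum fun n _ i => (hcoeff n).mul (by fun_prop)).symm
    _ = steinHaff p m φ (eig u) := steinHaff_congr fun i => by
        filter_upwards [(isOpen_chamber _).mem_nhds hu] with l hl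
        exact sum_interpCoeff_mul_pow φ hl i

theorem logDeriv_det_vandermonde_sq_mul_prod {r : ℕ} {l : ℝ → Fin r → ℝ} {w : Fin r → ℝ} {t : ℝ}
    (hl : HasDerivAt l w t) (hlt : l t ∈ chamber r) :
    logDeriv (fun s => (vandermonde (l s)).det ^ 2 * ∏ k, l s k) t
      = 2 * ∑ i, ∑ j ∈ Finset.Ioi i, (w j - w i) / (l t j - l t i) + ∑ k, w k / l t k := by
  have hcoord (i) : HasDerivAt (fun s => l s i) (w i) t := hasDerivAt_pi.mp hl i
  have hsub (i j) : HasDerivAt (fun s => l s j - l s i) (w j - w i) t :=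
    (hcoord j).fun_sub (hcoord i)
  have hne (i) : ∀ j ∈ Finset.Ioi i, l t j - l t i ≠ 0 := fun j hj =>
    sub_ne_zero.mpr (hlt.1.injective.ne (Finset.mem_Ioi.mp hj).ne')
  have hpos (k) : l t k ≠ 0 := (hlt.2 k).ne'
  have hrow (i) : DifferentiableAt ℝ (fun s => ∏ j ∈ Finset.Ioi i, (l s j - l s i)) t :=
    DifferentiableAt.fun_finsetProd fun j _ => (hsub i j).differentiableAt
  have hrow_ne (i) : ∏ j ∈ Finset.Ioi i, (l t j - l t i) ≠ 0 := Finset.prod_ne_zero_iff.mpr (hne i)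
  have hdet : DifferentiableAt ℝ (fun s => ∏ i, ∏ j ∈ Finset.Ioi i, (l s j - l s i)) t :=
    DifferentiableAt.fun_finsetProd fun i _ => hrow i
  simp only [det_vandermonde]
  have hdet_ne : (∏ i, ∏ j ∈ Finset.Ioi i, (l t j - l t i)) ^ 2 ≠ 0 :=
    pow_ne_zero 2 (Finset.prod_ne_zero_iff.mpr fun i _ => hrow_ne i)
  rw [logDeriv_mul t hdet_ne
      (Finset.prod_ne_zero_iff.mpr fun k _ => hpos k) (hdet.fun_pow 2)
      (DifferentiableAt.fun_finsetProd fun k _ => (hcoord k).differentiableAt),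
    logDeriv_fun_pow hdet, logDeriv_prod (fun i _ => hrow_ne i) fun i _ => hrow i,
    logDeriv_prod (fun k _ => hpos k) fun k _ => (hcoord k).differentiableAt, Nat.cast_ofNat]
  congr 2
  · refine Finset.sum_congr rfl fun i _ => ?_
    rw [logDeriv_prod (f := fun j s => l s j - l s i) (hne i)
      fun j _ => (hsub i j).differentiableAt]
    simp only [logDeriv_apply, (hsub i _).deriv]
  · simp only [logDeriv_apply, (hcoord _).deriv]

/-- The logarithmic derivative of `disc` along `spectralField φ`. -/
noncomputable def discRate {r : ℕ} (φ : Fin r → (Fin r → ℝ) → ℝ) (l : Fin r → ℝ) : ℝ :=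
  2 * ∑ i, ∑ j ∈ Finset.Ioi i, 2 * ((l j * φ j l - l i * φ i l) / (l j - l i)) + ∑ i, 2 * φ i l

theorem fderiv_disc_spectralField (φ : Fin (min p m) → (Fin (min p m) → ℝ) → ℝ)
    (hu : eig u ∈ chamber (min p m)) :
    fderiv ℝ disc u (spectralField φ u) = disc u * discRate φ (eig u) := by
  have heig : HasDerivAt (fun t : ℝ => eig (u + t • spectralField φ u))
      (fun i => 2 * eig u i * φ i (eig u)) 0 := by
    rw [← fderiv_eig_spectralField φ hu]
    exact (differentiableAt_eig hu).hasFDerivAt.hasLineDerivAt _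
  have hdisc : HasDerivAt (fun t : ℝ => disc (u + t • spectralField φ u))
      (fderiv ℝ disc u (spectralField φ u)) 0 :=
    ((contDiff_disc.differentiable one_ne_zero) u).hasFDerivAt.hasLineDerivAt _
  have hlog := logDeriv_det_vandermonde_sq_mul_prod heig
    (by simpa only [zero_smul, add_zero] using hu)
  simp only [← disc_eq, logDeriv_apply, hdisc.deriv, zero_smul, add_zero] at hlog
  rw [← mul_div_cancel₀ (fderiv ℝ disc u (spectralField φ u)) (disc_ne_zero_iff.mpr hu), hlog,
    discRate]
  have hquot (i) : 2 * eig u i * φ i (eig u) / eig u i = 2 * φ i (eig u) := by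
    have := (hu.2 i).ne'
    field_simp
  simp only [hquot]
  simp only [mul_assoc, ← mul_sub, mul_div_assoc]

end SpectralField

section DivergenceTheorem

theorem divergence_eq_sum_single {n : ℕ} (V : (Fin n → ℝ) → Fin n → ℝ) (x : Fin n → ℝ) :
    divergence V x = ∑ i, fderiv ℝ V x (Pi.single i 1) i := by
  rw [divergence, LinearMap.trace_eq_matrix_trace ℝ (Pi.basisFun ℝ (Fin n)), Matrix.trace]
  simp

theorem integral_divergence_pi_eq_zero {n : ℕ} {V : (Fin n → ℝ) → Fin n → ℝ}
    (hV : Differentiable ℝ V) (hsupp : HasCompactSupport V) (hint : Integrable (divergence V)) :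
    ∫ x, divergence V x = 0 := by
  obtain _ | n := n
  · simp [divergence_eq_sum_single]
  obtain ⟨R, hR, hball⟩ := hsupp.isCompact.isBounded.subset_ball_lt 0 0
  have hzero : ∀ x i, R ≤ |x i| → V x = 0 := fun x i hx =>
    image_eq_zero_of_notMem_tsupport fun hmem =>
      absurd (mem_ball_zero_iff.mp (hball hmem)) (hx.trans (norm_le_pi_norm x i)).not_gt
  have hout : ∀ x ∉ Set.Icc (fun _ => -R : Fin (n + 1) → ℝ) fun _ => R, divergence V x = 0 := by
    intro x hx
    have hmem : x ∉ tsupport V := fun hmem => hx <| by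
      have habs i := abs_le.mp
        ((norm_le_pi_norm x i).trans (mem_ball_zero_iff.mp (hball hmem)).le)
      exact ⟨fun i => (habs i).1, fun i => (habs i).2⟩
    have hloc : V =ᶠ[𝓝 x] fun _ => 0 := notMem_tsupport_iff_eventuallyEq.mp hmem
    rw [divergence, hloc.fderiv_eq, fderiv_fun_const]
    exact map_zero _
  have hface (i : Fin (n + 1)) (c : ℝ) (hc : R ≤ |c|) (y : Fin n → ℝ) :
      V (i.insertNth c y) i = 0 := by
    rw [hzero _ i (by rwa [Fin.insertNth_apply_same]), Pi.zero_apply]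
  rw [← setIntegral_eq_integral_of_forall_compl_eq_zero hout]
  rw [funext (divergence_eq_sum_single V)] at hint ⊢
  refine (integral_divergence_of_hasFDerivAt_off_countable' _ _ (fun _ => by simp [hR.le])
    (fun i x => V x i) (fun i x => (ContinuousLinearMap.proj i).comp (fderiv ℝ V x)) ∅
    Set.countable_empty
    (fun i => ((continuous_apply i).comp hV.continuous).continuousOn)
    (fun x _ i => hasFDerivAt_pi'.mp (hV x).hasFDerivAt i) hint.integrableOn).trans ?_
  simp [hface, le_abs_self]

variable {X : Type*} [NormedAddCommGroup X] [NormedSpace ℝ X]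

theorem divergence_conj {Y : Type*} [NormedAddCommGroup Y] [NormedSpace ℝ Y] (L : X ≃L[ℝ] Y)
    (V : X → X) (y : Y) : divergence (L ∘ V ∘ L.symm) y = divergence V (L.symm y) := by
  rw [divergence, divergence, L.comp_fderiv, L.symm.comp_right_fderiv]
  exact LinearMap.trace_conj' _ L.toLinearEquiv

theorem integral_divergence_eq_zero [FiniteDimensional ℝ X] [MeasurableSpace X] [BorelSpace X]
    (μ : Measure X) [μ.IsAddHaarMeasure] {V : X → X} (hV : Differentiable ℝ V)
    (hsupp : HasCompactSupport V) (hint : Integrable (divergence V) μ) :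
    ∫ x, divergence V x ∂μ = 0 := by
  let L : X ≃L[ℝ] (Fin (Module.finrank ℝ X) → ℝ) := (Module.finBasis ℝ X).equivFunL
  have hconj : divergence (L ∘ V ∘ L.symm) = divergence V ∘ L.symm :=
    funext (divergence_conj L V)
  have hL : MeasurableEmbedding L := L.toHomeomorph.measurableEmbedding
  have hcomp : (divergence V ∘ L.symm) ∘ L = divergence V := by ext; simp
  have : (μ.map L).IsAddHaarMeasure := L.isAddHaarMeasure_map μ
  set c := Measure.addHaarScalarFactor (μ.map L) volume with hc
  have hmap : μ.map L = c • volume := Measure.isAddLeftInvariant_eq_smul _ _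
  have hc0 : c ≠ 0 := fun h => NeZero.ne (μ.map L) (by rw [hmap, h, zero_smul])
  have hint' : Integrable (divergence V ∘ L.symm) := by
    rw [← hcomp, ← hL.integrable_map_iff, hmap] at hint
    exact (integrable_smul_measure (c := (c : ℝ≥0∞)) (by simpa using hc0) (by simp)).mp hint
  have hzero := integral_divergence_pi_eq_zero (V := L ∘ V ∘ L.symm) (by fun_prop)
    ((hsupp.comp_homeomorph L.symm.toHomeomorph).comp_left (map_zero L)) (hconj ▸ hint')
  calc ∫ x, divergence V x ∂μ = ∫ y, (divergence V ∘ L.symm) y ∂(μ.map L) := by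
        rw [hL.integral_map]; simp
    _ = c • ∫ y, divergence (L ∘ V ∘ L.symm) y := by
        rw [hmap, integral_smul_nnreal_measure, hconj]
    _ = 0 := by rw [hzero, smul_zero]

end DivergenceTheorem

section AlmostEverywhere

theorem measure_eq_zero_of_rays {X : Type*} [NormedAddCommGroup X] [NormedSpace ℝ X]
    [FiniteDimensional ℝ X] [MeasurableSpace X] [BorelSpace X] (μ : Measure X)
    [μ.IsAddHaarMeasure] {s : Set X} (hs : MeasurableSet s) (c : X)
    (h : ∀ w : X, ∀ᵐ t ∂volume.restrict (Set.Ioi (0 : ℝ)), c + t • w ∉ s) : μ s = 0 := by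
  have hmeas : MeasurableSet {x : X × ℝ | c + x.2 • x.1 ∉ s} :=
    (show Measurable fun x : X × ℝ => c + x.2 • x.1 by fun_prop) hs.compl
  have hswap : ∀ᵐ t ∂volume.restrict (Set.Ioi (0 : ℝ)), ∀ᵐ w ∂μ, c + t • w ∉ s :=
    (Measure.ae_ae_comm (p := fun w t => c + t • w ∉ s) hmeas).mp (.of_forall h)
  have : NeZero (volume.restrict (Set.Ioi (0 : ℝ))) := ⟨by simp⟩
  obtain ⟨t, ht, ht0⟩ := (hswap.and (ae_restrict_mem measurableSet_Ioi)).exists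
  replace ht0 : t ≠ 0 := ht0.ne'
  have hnull : μ ((t • ·) ⁻¹' ((c + ·) ⁻¹' s)) = 0 := by
    rw [ae_iff] at ht
    simp only [not_not] at ht
    exact ht
  rw [Measure.addHaar_preimage_smul μ ht0, mul_eq_zero, measure_preimage_add] at hnull
  exact hnull.resolve_left (by simp [ht0])

theorem ae_ne_zero_of_contDiff {X : Type*} [NormedAddCommGroup X] [NormedSpace ℝ X]
    [FiniteDimensional ℝ X] [MeasurableSpace X] [BorelSpace X] (μ : Measure X)
    [μ.IsAddHaarMeasure] {f : X → ℝ} (hf : ContDiff ℝ (⊤ : WithTop ℕ∞) f) {c : X} (hc : f c ≠ 0) :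
    ∀ᵐ x ∂μ, f x ≠ 0 := by
  refine measure_eq_zero_of_rays μ (s := {x | f x ≠ 0}ᶜ)
    (hf.continuous.measurable (measurableSet_singleton 0).compl).compl c fun w => ?_
  have hline : AnalyticOnNhd ℝ (fun t : ℝ => f (c + t • w)) Set.univ :=
    ContDiff.analyticOnNhd (hf.comp (contDiff_const.add (contDiff_id.smul contDiff_const)))
  have hcodisc := hline.preimage_zero_mem_codiscrete (x := 0) (by simpa using hc)
  have hae := ae_restrict_le_codiscreteWithin (μ := volume) MeasurableSet.univ hcodisc
  rw [Measure.restrict_univ] at hae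
  filter_upwards [ae_restrict_of_ae hae] with t ht
  simpa using ht

theorem exists_transpose_mul_self_eq_one {r n : ℕ} (h : r ≤ n) :
    ∃ H : Matrix (Fin n) (Fin r) ℝ, Hᵀ * H = 1 := by
  refine ⟨(1 : Matrix (Fin n) (Fin n) ℝ).submatrix id (Fin.castLE h), ?_⟩
  rw [transpose_submatrix, transpose_one, submatrix_mul _ _ _ id _ Function.bijective_id |>.symm,
    Matrix.one_mul, submatrix_one _ (Fin.castLE_injective h)]

theorem exists_eig_mem_chamber (p m : ℕ) :
    ∃ u : Fin m → Fin p → ℝ, eig u ∈ chamber (min p m) := by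
  obtain ⟨H, hH⟩ := exists_transpose_mul_self_eq_one (min_le_left p m)
  obtain ⟨G, hG⟩ := exists_transpose_mul_self_eq_one (min_le_right p m)
  let d : Fin (min p m) → ℝ := fun i => Real.exp (-i)
  have hd : d * d ∈ chamber (min p m) :=
    ⟨fun i j hij => mul_self_lt_mul_self (Real.exp_pos _).le (by simpa [d] using hij),
      fun i => mul_self_pos.mpr (Real.exp_pos _).ne'⟩
  refine ⟨Matrix.of.symm (G * diagonal d * Hᵀ), ?_⟩
  rwa [eig_eq_of_scatter_eq hH hd]
  calc (G * diagonal d * Hᵀ)ᵀ * (G * diagonal d * Hᵀ)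
      = H * (diagonal d * (Gᵀ * G) * diagonal d) * Hᵀ := by
        simp only [transpose_mul, transpose_transpose, diagonal_transpose, Matrix.mul_assoc]
    _ = H * diagonal (d * d) * Hᵀ := by
        rw [hG, Matrix.mul_one, diagonal_mul_diagonal]; rfl

theorem ae_eig_mem_chamber {p m : ℕ} :
    ∀ᵐ u : Fin m → Fin p → ℝ, eig u ∈ chamber (min p m) := by
  obtain ⟨u₀, hu₀⟩ := exists_eig_mem_chamber p m
  filter_upwards [ae_ne_zero_of_contDiff volume contDiff_disc (disc_ne_zero_iff.mpr hu₀)] with u hu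
  exact disc_ne_zero_iff.mp hu

end AlmostEverywhere

section SmoothStep

/-- A smooth function equal to `0` on `(-∞, 1]` and to `1` on `[2, ∞)`. -/
noncomputable def smoothStep (t : ℝ) : ℝ := Real.smoothTransition (t - 1)

theorem contDiff_smoothStep {n : ℕ∞} : ContDiff ℝ n smoothStep :=
  Real.smoothTransition.contDiff.comp (contDiff_id.sub contDiff_const)

theorem smoothStep_of_le {t : ℝ} (ht : t ≤ 1) : smoothStep t = 0 :=
  Real.smoothTransition.zero_of_nonpos (by linarith)

theorem smoothStep_of_ge {t : ℝ} (ht : 2 ≤ t) : smoothStep t = 1 :=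
  Real.smoothTransition.one_of_one_le (by linarith)

theorem norm_smoothStep_le (t : ℝ) : ‖smoothStep t‖ ≤ 1 := by
  rw [smoothStep, Real.norm_of_nonneg (Real.smoothTransition.nonneg _)]
  exact Real.smoothTransition.le_one _

theorem deriv_smoothStep_of_lt {t : ℝ} (ht : t < 1) : deriv smoothStep t = 0 := by
  have hloc : smoothStep =ᶠ[𝓝 t] fun _ => 0 :=
    (eventually_lt_nhds ht).mono fun s hs => smoothStep_of_le hs.le
  rw [hloc.deriv_eq, deriv_const]

theorem deriv_smoothStep_of_gt {t : ℝ} (ht : 2 < t) : deriv smoothStep t = 0 := by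
  have hloc : smoothStep =ᶠ[𝓝 t] fun _ => 1 :=
    (eventually_gt_nhds ht).mono fun s hs => smoothStep_of_ge hs.le
  rw [hloc.deriv_eq, deriv_const]

/-- The logarithmic rate of change `t χ'(t)` of the smooth step `χ`. -/
noncomputable def stepRate (t : ℝ) : ℝ := t * deriv smoothStep t

theorem continuous_stepRate : Continuous stepRate :=
  continuous_id.mul ((contDiff_smoothStep (n := 1)).continuous_deriv le_rfl)

theorem exists_norm_stepRate_le : ∃ C, ∀ t, ‖stepRate t‖ ≤ C := by
  refine (HasCompactSupport.intro (isCompact_Icc (a := 1) (b := 2)) fun t ht =>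
    ?_).exists_bound_of_continuous continuous_stepRate
  rw [Set.mem_Icc, not_and_or, not_le, not_le] at ht
  rw [stepRate, ht.elim deriv_smoothStep_of_lt deriv_smoothStep_of_gt, mul_zero]

end SmoothStep

section IntegrationByParts

variable {p m : ℕ} {φ : Fin (min p m) → (Fin (min p m) → ℝ) → ℝ}
  {w : (Fin m → Fin p → ℝ) → ℝ}

/-- The field `w • spectralField φ`, cut off where the eigenvalues come close to leaving the
chamber, i.e. where `disc` is below `1 / n`. -/
noncomputable def cutoffField (φ : Fin (min p m) → (Fin (min p m) → ℝ) → ℝ)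
    (w : (Fin m → Fin p → ℝ) → ℝ) (n : ℕ) (u : Fin m → Fin p → ℝ) : Fin m → Fin p → ℝ :=
  (smoothStep (n * disc u) * w u) • spectralField φ u

theorem differentiable_disc : Differentiable ℝ (disc : (Fin m → Fin p → ℝ) → ℝ) :=
  (contDiff_disc (n := 1)).differentiable one_ne_zero

theorem continuous_const_mul_disc (c : ℝ) : Continuous fun u : Fin m → Fin p → ℝ => c * disc u :=
  (differentiable_disc.const_mul c).continuous

theorem differentiable_smoothStep_mul_disc (n : ℕ) :
    Differentiable ℝ fun u : Fin m → Fin p → ℝ => smoothStep (n * disc u) :=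
  ((contDiff_smoothStep (n := 1)).differentiable one_ne_zero).comp
    (differentiable_disc.const_mul _)

theorem continuous_smoothStep_mul_disc (n : ℕ) :
    Continuous fun u : Fin m → Fin p → ℝ => smoothStep (n * disc u) :=
  (differentiable_smoothStep_mul_disc n).continuous

theorem continuous_stepRate_mul_disc (n : ℕ) :
    Continuous fun u : Fin m → Fin p → ℝ => stepRate (n * disc u) :=
  continuous_stepRate.comp (continuous_const_mul_disc _)

theorem differentiable_cutoffField
    (hφ : ∀ l ∈ chamber (min p m), ∀ i, DifferentiableAt ℝ (φ i) l) (hw : Differentiable ℝ w)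
    (n : ℕ) : Differentiable ℝ (cutoffField φ w n) := by
  intro u
  by_cases hu : eig u ∈ chamber (min p m)
  · exact ((differentiable_smoothStep_mul_disc n).mul hw u).smul
      (differentiableAt_spectralField hu (hφ _ hu))
  have hdisc : (n : ℝ) * disc u < 1 := by
    rw [not_ne_iff.mp (disc_ne_zero_iff.not.mpr hu), mul_zero]
    exact one_pos
  have hzero : cutoffField φ w n =ᶠ[𝓝 u] fun _ => 0 :=
    ((continuous_const_mul_disc _).continuousAt.eventually_lt_const hdisc).mono fun v hv => by
      rw [cutoffField, smoothStep_of_le hv.le, zero_mul, zero_smul]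
  exact (differentiableAt_const 0).congr_of_eventuallyEq hzero

theorem fderiv_smoothStep_mul_disc_spectralField (n : ℕ) {u : Fin m → Fin p → ℝ}
    (hu : eig u ∈ chamber (min p m)) :
    fderiv ℝ (fun v => smoothStep (n * disc v)) u (spectralField φ u)
      = stepRate (n * disc u) * discRate φ (eig u) := by
  have hstep := ((contDiff_smoothStep (n := 1)).differentiable one_ne_zero
    (n * disc u)).hasDerivAt
  have hcomp := (hstep.comp_hasFDerivAt u
    ((differentiable_disc u).hasFDerivAt.const_mul (n : ℝ))).fderiv
  rw [show (fun v => smoothStep (n * disc v)) = smoothStep ∘ fun v => (n : ℝ) * disc v from rfl,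
    hcomp]
  simp only [_root_.smul_apply, smul_eq_mul, fderiv_disc_spectralField φ hu, stepRate]
  ring

theorem divergence_cutoffField
    (hφ : ∀ l ∈ chamber (min p m), ∀ i, DifferentiableAt ℝ (φ i) l) (hw : Differentiable ℝ w)
    (n : ℕ) {u : Fin m → Fin p → ℝ} (hu : eig u ∈ chamber (min p m)) :
    divergence (cutoffField φ w n) u
      = smoothStep (n * disc u)
          * (w u * steinHaff p m φ (eig u) + fderiv ℝ w u (spectralField φ u))
        + stepRate (n * disc u) * (w u * discRate φ (eig u)) := by
  have hstep := differentiable_smoothStep_mul_disc n u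
  rw [show cutoffField φ w n
      = fun v => (smoothStep (n * disc v) * w v) • spectralField φ v from rfl,
    divergence_smul (hstep.fun_mul (hw u)) (differentiableAt_spectralField hu (hφ _ hu)),
    divergence_spectralField hu (hφ _ hu), fderiv_fun_mul hstep (hw u)]
  simp only [_root_.add_apply, _root_.smul_apply, smul_eq_mul,
    fderiv_smoothStep_mul_disc_spectralField n hu]
  ring

theorem tendsto_integral_smoothStep_mul_add {g h : (Fin m → Fin p → ℝ) → ℝ} (hg : Integrable g)
    (hh : Integrable h) :
    Tendsto (fun n : ℕ => ∫ u, smoothStep (n * disc u) * g u + stepRate (n * disc u) * h u) atTop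
      (𝓝 (∫ u, g u)) := by
  obtain ⟨C, hC⟩ := exists_norm_stepRate_le
  refine tendsto_integral_of_dominated_convergence (fun u => ‖g u‖ + C * ‖h u‖) (fun n => ?_)
    (hg.norm.add (hh.norm.const_mul C)) (fun n => .of_forall fun u => ?_) ?_
  · exact ((continuous_smoothStep_mul_disc n).aestronglyMeasurable.mul
      hg.aestronglyMeasurable).add
      ((continuous_stepRate_mul_disc n).aestronglyMeasurable.mul hh.aestronglyMeasurable)
  · refine (norm_add_le _ _).trans (add_le_add ?_ ?_) <;> rw [norm_mul]
    · exact mul_le_of_le_one_left (norm_nonneg _) (norm_smoothStep_le _)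
    · exact mul_le_mul_of_nonneg_right (hC _) (norm_nonneg _)
  · filter_upwards [ae_eig_mem_chamber] with u hu
    have hpos : 0 < disc u := (disc_nonneg u).lt_of_ne' (disc_ne_zero_iff.mpr hu)
    have hlarge := (tendsto_natCast_atTop_atTop (R := ℝ)).atTop_mul_const hpos
    refine tendsto_const_nhds.congr' ((hlarge.eventually_gt_atTop 2).mono fun n hn => ?_)
    simp only [smoothStep_of_ge hn.le, stepRate, deriv_smoothStep_of_gt hn]
    ring

theorem integral_mul_steinHaff
    (hφ : ∀ l ∈ chamber (min p m), ∀ i, DifferentiableAt ℝ (φ i) l) (hw : Differentiable ℝ w)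
    (hsupp : HasCompactSupport w) (hint : Integrable fun u => w u * steinHaff p m φ (eig u))
    (hint_fderiv : Integrable fun u => fderiv ℝ w u (spectralField φ u))
    (hint_disc : Integrable fun u => w u * discRate φ (eig u)) :
    ∫ u, w u * steinHaff p m φ (eig u) = - ∫ u, fderiv ℝ w u (spectralField φ u) := by
  have hsum := hint.add hint_fderiv
  have hdiv (n : ℕ) := ae_eig_mem_chamber.mono fun u hu => divergence_cutoffField hφ hw n hu
  obtain ⟨C, hC⟩ := exists_norm_stepRate_le
  have hzero (n : ℕ) : ∫ u, smoothStep (n * disc u)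
          * (w u * steinHaff p m φ (eig u) + fderiv ℝ w u (spectralField φ u))
        + stepRate (n * disc u) * (w u * discRate φ (eig u)) = 0 := by
    rw [← integral_congr_ae (hdiv n)]
    refine integral_divergence_eq_zero volume (differentiable_cutoffField hφ hw n)
      (hsupp.mul_left.smul_right) ((integrable_congr (hdiv n)).mpr ?_)
    exact (hsum.bdd_mul (continuous_smoothStep_mul_disc n).aestronglyMeasurable
      (.of_forall fun u => norm_smoothStep_le _)).add
      (hint_disc.bdd_mul (continuous_stepRate_mul_disc n).aestronglyMeasurable
        (.of_forall fun u => hC _))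
  have hlim := tendsto_integral_smoothStep_mul_add hsum hint_disc
  simp only [Pi.add_apply, hzero] at hlim
  rw [eq_neg_iff_add_eq_zero, ← integral_add hint hint_fderiv]
  exact tendsto_nhds_unique hlim tendsto_const_nhds

end IntegrationByParts

section RowForm

variable {p m : ℕ} {Sig : Matrix (Fin p) (Fin p) ℝ}

/-- `tr u Σ⁻¹ uᵀ`. -/
noncomputable def rowForm (Sig : Matrix (Fin p) (Fin p) ℝ) (u : Fin m → Fin p → ℝ) : ℝ :=
  (Matrix.of u * Sig⁻¹ * (Matrix.of u)ᵀ).trace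

theorem rowForm_eq_trace_mul_scatter (Sig : Matrix (Fin p) (Fin p) ℝ) (u : Fin m → Fin p → ℝ) :
    rowForm Sig u = (Sig⁻¹ * scatter u).trace := by
  rw [rowForm, Matrix.mul_assoc, trace_mul_comm, scatter, Matrix.mul_assoc]

theorem rowForm_eq_sum_dotProduct (Sig : Matrix (Fin p) (Fin p) ℝ) (u : Fin m → Fin p → ℝ) :
    rowForm Sig u = ∑ a, star (u a) ⬝ᵥ (Sig⁻¹ *ᵥ u a) := by
  simp only [rowForm, trace, diag_apply, Matrix.mul_assoc, mul_apply_eq_vecMul, star_trivial]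
  exact Finset.sum_congr rfl fun a _ => congrArg (u a ⬝ᵥ ·) rfl

theorem rowForm_nonneg (hSig : Sig.PosDef) (u : Fin m → Fin p → ℝ) : 0 ≤ rowForm Sig u := by
  rw [rowForm_eq_sum_dotProduct]
  exact Finset.sum_nonneg fun a _ => hSig.inv.posSemidef.dotProduct_mulVec_nonneg _

theorem rowForm_pos (hSig : Sig.PosDef) {u : Fin m → Fin p → ℝ} (hu : u ≠ 0) :
    0 < rowForm Sig u := by
  rw [rowForm_eq_sum_dotProduct]
  obtain ⟨a, ha⟩ := Function.ne_iff.mp hu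
  exact Finset.sum_pos' (fun a _ => hSig.inv.posSemidef.dotProduct_mulVec_nonneg _)
    ⟨a, Finset.mem_univ a, hSig.inv.dotProduct_mulVec_pos ha⟩

theorem rowForm_smul (Sig : Matrix (Fin p) (Fin p) ℝ) (s : ℝ) (u : Fin m → Fin p → ℝ) :
    rowForm Sig (s • u) = s ^ 2 * rowForm Sig u := by
  simp only [rowForm_eq_sum_dotProduct, Pi.smul_apply, star_trivial, mulVec_smul, smul_dotProduct,
    dotProduct_smul, smul_eq_mul, sq, Finset.mul_sum, mul_assoc]

theorem contDiff_rowForm (Sig : Matrix (Fin p) (Fin p) ℝ) {n : WithTop ℕ∞} :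
    ContDiff ℝ n (rowForm Sig : (Fin m → Fin p → ℝ) → ℝ) := by
  simp only [funext (rowForm_eq_trace_mul_scatter Sig), trace, diag_apply, mul_apply]
  exact ContDiff.sum fun b _ => ContDiff.sum fun c _ =>
    contDiff_const.mul (contDiff_scatter c b)

theorem continuous_rowForm (Sig : Matrix (Fin p) (Fin p) ℝ) :
    Continuous (rowForm Sig : (Fin m → Fin p → ℝ) → ℝ) :=
  (contDiff_rowForm Sig (n := 0)).continuous

theorem exists_mul_sq_norm_le_rowForm (hSig : Sig.PosDef) :
    ∃ c > 0, ∀ u : Fin m → Fin p → ℝ, c * ‖u‖ ^ 2 ≤ rowForm Sig u := by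
  obtain ⟨c, hc, hle⟩ := (isCompact_sphere (0 : Fin m → Fin p → ℝ) 1).exists_forall_le'
    (continuous_rowForm Sig).continuousOn (a := 0)
    fun u hu => rowForm_pos hSig (ne_zero_of_mem_unit_sphere ⟨u, hu⟩)
  refine ⟨c, hc, fun u => ?_⟩
  rcases eq_or_ne u 0 with rfl | hu
  · simpa using rowForm_nonneg hSig 0
  · have h := hle (‖u‖⁻¹ • u) (by simpa using norm_smul_inv_norm (𝕜 := ℝ) hu)
    rw [rowForm_smul, inv_pow, ← div_eq_inv_mul] at h
    exact (le_div_iff₀ (by positivity)).mp h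

theorem isCompact_setOf_rowForm_le (hSig : Sig.PosDef) (t : ℝ) :
    IsCompact {u : Fin m → Fin p → ℝ | rowForm Sig u ≤ t} := by
  obtain ⟨c, hc, hle⟩ := exists_mul_sq_norm_le_rowForm (m := m) hSig
  refine Metric.isCompact_of_isClosed_isBounded (isClosed_le (continuous_rowForm Sig)
    continuous_const) (isBounded_iff_forall_norm_le.mpr ⟨√(t / c), fun u hu => ?_⟩)
  exact Real.le_sqrt_of_sq_le ((le_div_iff₀' hc).mpr ((hle u).trans hu))

theorem transpose_mul_diagonal_mul_transpose {r : ℕ} (H : Matrix (Fin p) (Fin r) ℝ)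
    (d : Fin r → ℝ) : (H * diagonal d * Hᵀ)ᵀ = H * diagonal d * Hᵀ := by
  simp only [transpose_mul, diagonal_transpose, transpose_transpose, Matrix.mul_assoc]

theorem trace_mul_mul_diagonal_mul_transpose {r : ℕ} (M : Matrix (Fin p) (Fin p) ℝ)
    (H : Matrix (Fin p) (Fin r) ℝ) (d : Fin r → ℝ) :
    (M * (H * diagonal d * Hᵀ)).trace = ∑ k, (Hᵀ * M * H) k k * d k := by
  rw [← Matrix.mul_assoc, trace_mul_comm, ← Matrix.mul_assoc, ← Matrix.mul_assoc]
  simp only [trace, diag_apply, mul_diagonal]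

variable {φ : Fin (min p m) → (Fin (min p m) → ℝ) → ℝ} {u : Fin m → Fin p → ℝ}

theorem fderiv_rowForm_apply (Sig : Matrix (Fin p) (Fin p) ℝ) (u W : Fin m → Fin p → ℝ) :
    fderiv ℝ (rowForm Sig) u W
      = (Sig⁻¹ * ((Matrix.of W)ᵀ * Matrix.of u + (Matrix.of u)ᵀ * Matrix.of W)).trace := by
  refine fderiv_eq_of_hasLineDerivAt
    ((contDiff_rowForm Sig (n := 1)).differentiable one_ne_zero u) ?_
  simp only [HasLineDerivAt, rowForm_eq_trace_mul_scatter, trace, diag_apply,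
    Matrix.mul_apply (M := Sig⁻¹)]
  exact HasDerivAt.fun_sum fun b _ => HasDerivAt.fun_sum fun c _ =>
    (hasDerivAt_matrix_iff.mp (hasDerivAt_scatter_add_smul u W) c b).const_mul _

theorem fderiv_rowForm_spectralField (hSig : Sig.PosDef)
    (φ : Fin (min p m) → (Fin (min p m) → ℝ) → ℝ) (hu : eig u ∈ chamber (min p m))
    {H : Matrix (Fin p) (Fin (min p m)) ℝ} (hH : IsEigenvectorMatrix u H) :
    fderiv ℝ (rowForm Sig) u (spectralField φ u) = 2 * traceTerm Sig H (eig u) φ := by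
  have hsymm : (H * diagonal (fun i => φ i (eig u)) * Hᵀ)ᵀ
      = H * diagonal (fun i => φ i (eig u)) * Hᵀ := transpose_mul_diagonal_mul_transpose H _
  have hSigT : (Sig⁻¹)ᵀ = Sig⁻¹ := by
    simpa only [IsHermitian, conjTranspose_eq_transpose_of_trivial] using hSig.inv.isHermitian
  have hprod : scatter u * (H * diagonal (fun i => φ i (eig u)) * Hᵀ)
      = H * diagonal (eig u) * diagonal (fun i => φ i (eig u)) * Hᵀ := by
    simp only [hH.2, Matrix.mul_assoc]
    rw [← Matrix.mul_assoc Hᵀ, hH.1, Matrix.one_mul]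
  have hswap : (Sig⁻¹ * ((H * diagonal (fun i => φ i (eig u)) * Hᵀ) * scatter u)).trace
      = (Sig⁻¹ * (scatter u * (H * diagonal (fun i => φ i (eig u)) * Hᵀ))).trace := by
    rw [← trace_transpose, transpose_mul, transpose_mul, hSigT, hsymm,
      ← pow_one (scatter u), transpose_scatter_pow, trace_mul_comm]
  rw [fderiv_rowForm_apply, spectralField_eq φ hu hH, Equiv.apply_symm_apply, transpose_mul, hsymm,
    Matrix.mul_assoc, ← Matrix.mul_assoc _ᵀ, ← scatter, Matrix.mul_add, trace_add, hswap, hprod,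
    traceTerm, two_mul]

theorem abs_traceTerm_le (hSig : Sig.PosDef) (φ : Fin (min p m) → (Fin (min p m) → ℝ) → ℝ)
    {H : Matrix (Fin p) (Fin (min p m)) ℝ} (hH : IsEigenvectorMatrix u H) :
    |traceTerm Sig H (eig u) φ| ≤ rowForm Sig u * ∑ i, |φ i (eig u)| := by
  have hG (k) : 0 ≤ (Hᵀ * Sig⁻¹ * H) k k := by
    have := hSig.inv.posSemidef.conjTranspose_mul_mul_same H
    exact (conjTranspose_eq_transpose_of_trivial H ▸ this).diag_nonneg
  have hGe (k) : 0 ≤ (Hᵀ * Sig⁻¹ * H) k k * eig u k := mul_nonneg (hG k) (eig_nonneg u k)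
  rw [traceTerm, Matrix.mul_assoc H, diagonal_mul_diagonal, trace_mul_mul_diagonal_mul_transpose,
    rowForm_eq_trace_mul_scatter, hH.2, trace_mul_mul_diagonal_mul_transpose, Finset.sum_mul]
  refine (Finset.abs_sum_le_sum_abs _ _).trans (Finset.sum_le_sum fun k _ => ?_)
  rw [← mul_assoc, abs_mul, abs_of_nonneg (hGe k)]
  exact mul_le_mul_of_nonneg_left (Finset.single_le_sum (f := fun i => |φ i (eig u)|)
    (fun _ _ => abs_nonneg _) (Finset.mem_univ k)) (hGe k)

theorem volume_setOf_sq_mul_mem_eq_zero {N : Set ℝ} (hN : volume N = 0) {a : ℝ} (ha : 0 < a) :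
    volume {t : ℝ | 0 < t ∧ t ^ 2 * a ∈ N} = 0 := by
  have himage : volume ((fun s => √(s / a)) '' (N ∩ Set.Ioi 0)) = 0 := by
    refine addHaar_image_eq_zero_of_differentiableOn_of_addHaar_eq_zero volume (fun s hs => ?_)
      (measure_mono_null Set.inter_subset_left hN)
    exact ((differentiableAt_id.div_const _).sqrt (div_pos hs.2 ha).ne').differentiableWithinAt
  refine measure_mono_null (fun t ht => ?_) himage
  refine ⟨t ^ 2 * a, ⟨ht.2, mul_pos (pow_pos ht.1 2) ha⟩, ?_⟩
  simp only [mul_div_cancel_right₀ _ ha.ne', Real.sqrt_sq ht.1.le]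

theorem quasiMeasurePreserving_rowForm (hSig : Sig.PosDef) (hp : 0 < p) (hm : 0 < m) :
    Measure.QuasiMeasurePreserving (rowForm Sig : (Fin m → Fin p → ℝ) → ℝ) := by
  have : Nonempty (Fin p) := ⟨⟨0, hp⟩⟩
  have : Nonempty (Fin m) := ⟨⟨0, hm⟩⟩
  have hmeas := (continuous_rowForm (m := m) Sig).measurable
  refine ⟨hmeas, Measure.AbsolutelyContinuous.mk fun N hN hN0 => ?_⟩
  rw [Measure.map_apply hmeas hN]
  have hpos : volume (rowForm Sig ⁻¹' N \ {(0 : Fin m → Fin p → ℝ)}) = 0 := by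
    refine measure_eq_zero_of_rays volume ((hmeas hN).diff (measurableSet_singleton 0)) 0
      fun w => ?_
    rw [ae_restrict_iff' measurableSet_Ioi, ae_iff]
    rcases eq_or_ne w 0 with rfl | hw
    · simp
    · refine measure_mono_null (fun t ht => ?_)
        (volume_setOf_sq_mul_mem_eq_zero hN0 (rowForm_pos hSig hw))
      simp only [zero_add, Classical.not_imp, not_not, Set.mem_ofPred_eq, Set.mem_sdiff,
        Set.mem_preimage, rowForm_smul] at ht
      exact ⟨ht.1, ht.2.1⟩
  exact measure_mono_null (Set.subset_sdiff_union _ {0})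
    (measure_union_null hpos (measure_singleton 0))

end RowForm

section Weights

theorem locallyIntegrable_of_abs_le {k : ℝ → ℝ} {C : ℝ} (hk : Measurable k)
    (hC : ∀ s, |k s| ≤ C) : LocallyIntegrable k :=
  (locallyIntegrable_const C).mono hk.aestronglyMeasurable
    (.of_forall fun s => (hC s).trans (le_abs_self C))

theorem intervalIntegrable_of_locallyIntegrable {k : ℝ → ℝ} (hk : LocallyIntegrable k)
    (a b : ℝ) : IntervalIntegrable k volume a b :=
  intervalIntegrable_iff.mpr
    ((hk.integrableOn_isCompact isCompact_uIcc).mono_set Set.uIoc_subset_uIcc)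

section LowerSet

variable {D : Set ℝ} {k : ℝ → ℝ} {t C : ℝ}

theorem setIntegral_Ioi_eq_zero (hD : IsLowerSet D) (hkD : ∀ s ∉ D, k s = 0) {y : ℝ}
    (hy : y ∉ D) : ∫ s in Set.Ioi y, k s = 0 :=
  setIntegral_eq_zero_of_forall_eq_zero fun s hs => hkD s fun hsD => hy (hD (le_of_lt hs) hsD)

theorem setIntegral_Ioi_eq_intervalIntegral (hDt : D ⊆ Set.Iic t) (hkD : ∀ s ∉ D, k s = 0)
    (y : ℝ) : ∫ s in Set.Ioi y, k s = ∫ s in y..t, k s := by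
  have hk (s) (hs : t < s) : k s = 0 := hkD s fun hsD => (hDt hsD).not_gt hs
  rcases le_total y t with hyt | hty
  · rw [intervalIntegral.integral_of_le hyt]
    exact setIntegral_eq_of_subset_of_forall_sdiff_eq_zero measurableSet_Ioi
      Set.Ioc_subset_Ioi_self fun s hs => hk s (not_le.mp fun hst => hs.2 ⟨hs.1, hst⟩)
  · have hIoi : ∀ s ∈ Set.Ioi y, k s = 0 := fun s hs => hk s (hty.trans_lt hs)
    have hIoc : ∀ s ∈ Set.Ioc t y, k s = 0 := fun s hs => hk s hs.1
    rw [intervalIntegral.integral_of_ge hty, setIntegral_eq_zero_of_forall_eq_zero hIoi,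
      setIntegral_eq_zero_of_forall_eq_zero hIoc, neg_zero]

theorem continuous_setIntegral_Ioi (hDt : D ⊆ Set.Iic t) (hkD : ∀ s ∉ D, k s = 0)
    (hk : LocallyIntegrable k) : Continuous fun y => ∫ s in Set.Ioi y, k s := by
  simp only [setIntegral_Ioi_eq_intervalIntegral hDt hkD, intervalIntegral.integral_symm t]
  exact (intervalIntegral.continuous_primitive (intervalIntegrable_of_locallyIntegrable hk) t).neg

theorem abs_setIntegral_Ioi_le (hDt : D ⊆ Set.Iic t) (hkD : ∀ s ∉ D, k s = 0)
    (hC : ∀ s, |k s| ≤ C) {y : ℝ} (hy : 0 ≤ y) : |∫ s in Set.Ioi y, k s| ≤ C * |t| := by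
  have hC0 : 0 ≤ C := (abs_nonneg _).trans (hC 0)
  rcases le_total y t with hyt | hty
  · rw [setIntegral_Ioi_eq_intervalIntegral hDt hkD]
    refine (intervalIntegral.norm_integral_le_of_norm_le_const (f := k) fun s _ => hC s).trans ?_
    rw [abs_of_nonneg (sub_nonneg.mpr hyt), abs_of_nonneg (hy.trans hyt)]
    gcongr
    linarith
  · have hIoi : ∀ s ∈ Set.Ioi y, k s = 0 := fun s hs =>
      hkD s fun hsD => (hDt hsD).not_gt (hty.trans_lt hs)
    rw [setIntegral_eq_zero_of_forall_eq_zero hIoi, abs_zero]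
    positivity

theorem hasDerivAt_setIntegral_Ioi (hDt : D ⊆ Set.Iic t) (hkD : ∀ s ∉ D, k s = 0)
    (hk : Continuous k) (y : ℝ) : HasDerivAt (fun y => ∫ s in Set.Ioi y, k s) (-k y) y := by
  simp only [setIntegral_Ioi_eq_intervalIntegral hDt hkD]
  exact intervalIntegral.integral_hasDerivAt_left (hk.intervalIntegrable y t)
    (hk.stronglyMeasurableAtFilter _ _) hk.continuousAt

theorem tendsto_setIntegral_Ioi {w : ℕ → ℝ → ℝ} (hDt : D ⊆ Set.Iic t)
    (hwD : ∀ n, ∀ s ∉ D, w n s = 0) (hkD : ∀ s ∉ D, k s = 0)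
    (hw : ∀ n, Measurable (w n)) (hC : ∀ n s, |w n s| ≤ C)
    (hlim : ∀ᵐ s, Tendsto (fun n => w n s) atTop (𝓝 (k s))) (y : ℝ) :
    Tendsto (fun n => ∫ s in Set.Ioi y, w n s) atTop (𝓝 (∫ s in Set.Ioi y, k s)) := by
  simp only [setIntegral_Ioi_eq_intervalIntegral hDt hkD,
    setIntegral_Ioi_eq_intervalIntegral hDt (hwD _)]
  exact intervalIntegral.tendsto_integral_filter_of_dominated_convergence (fun _ => C)
    (.of_forall fun n => (hw n).aestronglyMeasurable)
    (.of_forall fun n => .of_forall fun s _ => hC n s)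
    intervalIntegrable_const (hlim.mono fun s hs _ => hs)

/-- The average of `k` over `[y, y + δ]`. Averaging forward keeps weights supported in a lower
set. -/
noncomputable def forwardAverage (δ : ℝ) (k : ℝ → ℝ) (y : ℝ) : ℝ :=
  δ⁻¹ * ∫ s in y..(y + δ), k s

variable {δ : ℝ}

theorem continuous_forwardAverage (hk : LocallyIntegrable k) :
    Continuous (forwardAverage δ k) := by
  have hint := intervalIntegrable_of_locallyIntegrable hk
  have hprim := intervalIntegral.continuous_primitive hint 0
  exact (continuous_const.mul ((hprim.comp (continuous_id.add_const δ)).sub hprim)).congr fun y =>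
    congrArg (δ⁻¹ * ·) (intervalIntegral.integral_interval_sub_left (hint 0 _) (hint 0 _))

theorem abs_forwardAverage_le (hδ : 0 < δ) (hC : ∀ s, |k s| ≤ C) (y : ℝ) :
    |forwardAverage δ k y| ≤ C := by
  have h : |∫ s in y..(y + δ), k s| ≤ C * |y + δ - y| :=
    intervalIntegral.norm_integral_le_of_norm_le_const (f := k) fun s _ => hC s
  rw [add_sub_cancel_left, abs_of_pos hδ] at h
  rw [forwardAverage, abs_mul, abs_inv, abs_of_pos hδ, inv_mul_le_iff₀ hδ]
  linarith

theorem forwardAverage_eq_zero (hδ : 0 < δ) (hD : IsLowerSet D) (hkD : ∀ s ∉ D, k s = 0) {y : ℝ}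
    (hy : y ∉ D) : forwardAverage δ k y = 0 := by
  rw [forwardAverage, intervalIntegral.integral_of_le (by linarith),
    setIntegral_eq_zero_of_forall_eq_zero fun s hs => hkD s fun hsD => hy (hD hs.1.le hsD),
    mul_zero]

theorem ae_tendsto_forwardAverage (hk : LocallyIntegrable k) :
    ∀ᵐ y, Tendsto (fun δ => forwardAverage δ k y) (𝓝[>] 0) (𝓝 (k y)) := by
  filter_upwards [LocallyIntegrable.ae_hasDerivAt_integral hk] with y hy
  have hint := intervalIntegrable_of_locallyIntegrable hk
  simpa only [forwardAverage, smul_eq_mul,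
    intervalIntegral.integral_interval_sub_left (hint 0 _) (hint 0 _)]
    using (hy 0).tendsto_slope_zero_right

end LowerSet

variable {X : Type*} [MeasurableSpace X] {μ : Measure X} {q A B : X → ℝ}

theorem integrable_mul_of_abs_le {w : X → ℝ} {s : Set X} {C : ℝ} (hs : MeasurableSet s)
    (hA : IntegrableOn A s μ) (hw : AEStronglyMeasurable w μ) (hC : ∀ x, |w x| ≤ C)
    (hws : ∀ x ∉ s, w x = 0) : Integrable (fun x => w x * A x) μ := by
  refine ((hA.integrable_indicator hs).bdd_mul hw (.of_forall hC)).congr (.of_forall fun x => ?_)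
  by_cases hx : x ∈ s
  · simp only [Set.indicator_of_mem hx]
  · simp only [hws x hx, zero_mul]

theorem integrable_indicator_const_mul {s : Set X} {b : ℝ} (hs : MeasurableSet s)
    (hA : IntegrableOn A s μ) : Integrable (fun x => s.indicator (fun _ => b) x * A x) μ :=
  ((hA.integrable_indicator hs).const_mul b).congr (.of_forall fun x => by
    by_cases hx : x ∈ s <;> simp [hx])

theorem abs_le_indicator {α : Type*} {s : Set α} {a b : ℝ} {x : α} (hab : |a| ≤ b)
    (ha : x ∉ s → a = 0) : |a| ≤ s.indicator (fun _ => b) x := by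
  by_cases hx : x ∈ s
  · rwa [Set.indicator_of_mem hx]
  · rw [Set.indicator_of_notMem hx, ha hx, abs_zero]

theorem tendsto_integral_mul {w : ℕ → X → ℝ} {v b : X → ℝ} (hA : AEStronglyMeasurable A μ)
    (hw : ∀ n, AEStronglyMeasurable (w n) μ) (hb : Integrable (fun x => b x * A x) μ)
    (hwb : ∀ n, ∀ᵐ x ∂μ, |w n x| ≤ b x)
    (hlim : ∀ᵐ x ∂μ, Tendsto (fun n => w n x) atTop (𝓝 (v x))) :
    Tendsto (fun n => ∫ x, w n x * A x ∂μ) atTop (𝓝 (∫ x, v x * A x ∂μ)) := by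
  refine tendsto_integral_of_dominated_convergence (fun x => |b x * A x|)
    (fun n => (hw n).mul hA) hb.abs (fun n => (hwb n).mono fun x hx => ?_)
    (hlim.mono fun x hx => hx.mul_const _)
  rw [Real.norm_eq_abs, abs_mul, abs_mul]
  exact mul_le_mul_of_nonneg_right (hx.trans (le_abs_self _)) (abs_nonneg _)

theorem integral_comp_mul_eq_of_continuous {D : Set ℝ} {t : ℝ}
    (hq : Measure.QuasiMeasurePreserving q μ) (hq0 : ∀ x, 0 ≤ q x) (hD : IsLowerSet D)
    (hDt : D ⊆ Set.Iic t) (hA : AEStronglyMeasurable A μ) (hB : AEStronglyMeasurable B μ)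
    (hAD : IntegrableOn A (q ⁻¹' D) μ) (hBD : IntegrableOn B (q ⁻¹' D) μ)
    (h : ∀ k : ℝ → ℝ, ∀ C, Continuous k → (∀ s, |k s| ≤ C) → (∀ s ∉ D, k s = 0) →
      ∫ x, k (q x) * A x ∂μ = ∫ x, (∫ s in Set.Ioi (q x), k s) * B x ∂μ)
    {k : ℝ → ℝ} {C : ℝ} (hk : Measurable k) (hC : ∀ s, |k s| ≤ C) (hkD : ∀ s ∉ D, k s = 0) :
    ∫ x, k (q x) * A x ∂μ = ∫ x, (∫ s in Set.Ioi (q x), k s) * B x ∂μ := by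
  have hDm : MeasurableSet (q ⁻¹' D) := hq.measurable hD.ordConnected.measurableSet
  have hkint := locallyIntegrable_of_abs_le hk hC
  set w : ℕ → ℝ → ℝ := fun n => forwardAverage (1 / ((n : ℝ) + 1)) k
  have hpos (n : ℕ) : 0 < 1 / ((n : ℝ) + 1) := Nat.one_div_pos_of_nat
  have hwcont (n) : Continuous (w n) := continuous_forwardAverage hkint
  have hwC (n) (s) : |w n s| ≤ C := abs_forwardAverage_le (hpos n) hC s
  have hwD (n) (s) (hs : s ∉ D) : w n s = 0 := forwardAverage_eq_zero (hpos n) hD hkD hs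
  have hwlim : ∀ᵐ s, Tendsto (fun n => w n s) atTop (𝓝 (k s)) :=
    (ae_tendsto_forwardAverage hkint).mono fun s hs => hs.comp
      (tendsto_nhdsWithin_iff.mpr ⟨tendsto_one_div_add_atTop_nhds_zero_nat, .of_forall hpos⟩)
  have hbound (b : ℝ) {F : X → ℝ} (hF : IntegrableOn F (q ⁻¹' D) μ) :
      Integrable (fun x => (q ⁻¹' D).indicator (fun _ => b) x * F x) μ :=
    integrable_indicator_const_mul hDm hF
  have hleft : Tendsto (fun n => ∫ x, w n (q x) * A x ∂μ) atTop (𝓝 (∫ x, k (q x) * A x ∂μ)) :=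
    tendsto_integral_mul hA
      (fun n => ((hwcont n).measurable.comp hq.measurable).aestronglyMeasurable) (hbound C hAD)
      (fun n => .of_forall fun x => abs_le_indicator (hwC n _) (hwD n _))
      (hq.ae hwlim)
  have hright : Tendsto (fun n => ∫ x, (∫ s in Set.Ioi (q x), w n s) * B x ∂μ) atTop
      (𝓝 (∫ x, (∫ s in Set.Ioi (q x), k s) * B x ∂μ)) :=
    tendsto_integral_mul hB
      (fun n => ((continuous_setIntegral_Ioi hDt (hwD n)
        (hwcont n).locallyIntegrable).measurable.comp hq.measurable).aestronglyMeasurable)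
      (hbound (C * |t|) hBD)
      (fun n => .of_forall fun x => abs_le_indicator
        (abs_setIntegral_Ioi_le hDt (hwD n) (hwC n) (hq0 x))
        (setIntegral_Ioi_eq_zero hD (hwD n)))
      (.of_forall fun x =>
        tendsto_setIntegral_Ioi hDt hwD hkD (fun n => (hwcont n).measurable) hwC hwlim _)
  refine tendsto_nhds_unique hleft (hright.congr fun n => ?_)
  exact (h (w n) C (hwcont n) (hwC n) (hwD n)).symm

end Weights

section UpperTail

/-- The tail integral `∫_y^∞ g` of a generator `g`; the generator `F*` is half the tail of `f`. -/
noncomputable def upperTail (g : ℝ → ℝ≥0) (y : ℝ) : ℝ≥0∞ :=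
  ∫⁻ s in Set.Ioi y, g s

variable {g : ℝ → ℝ≥0} {y : ℝ}

theorem antitone_upperTail : Antitone (upperTail g) := fun _ _ h =>
  lintegral_mono_set (Set.Ioi_subset_Ioi h)

theorem integrableOn_Ioi_of_upperTail_ne_top (hg : Measurable g) (hy : upperTail g y ≠ ∞) :
    IntegrableOn (fun s => (g s : ℝ)) (Set.Ioi y) :=
  integrable_toReal_of_lintegral_ne_top hg.coe_nnreal_ennreal.aemeasurable hy

theorem setIntegral_Ioi_eq_toReal_upperTail (hg : Measurable g) :
    ∫ s in Set.Ioi y, (g s : ℝ) = (upperTail g y).toReal := by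
  rw [integral_eq_lintegral_of_nonneg_ae (.of_forall fun s => (g s).coe_nonneg)
    hg.coe_nnreal_real.aestronglyMeasurable]
  simp only [ENNReal.ofReal_coe_nnreal, upperTail]

theorem ae_eq_zero_of_upperTail_eq_zero (hg : Measurable g) :
    ∀ᵐ s, upperTail g s = 0 → g s = 0 := by
  have hrat (t : ℚ) : ∀ᵐ s, upperTail g t = 0 → (t : ℝ) < s → g s = 0 := by
    by_cases ht : upperTail g t = 0
    · have h := (lintegral_eq_zero_iff hg.coe_nnreal_ennreal).mp ht
      filter_upwards [(ae_restrict_iff' measurableSet_Ioi).mp h] with s hs _ hts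
      exact ENNReal.coe_eq_zero.mp (hs hts)
    · exact .of_forall fun s h => absurd h ht
  have hleast : volume {s | IsLeast {t | upperTail g t = 0} s} = 0 :=
    Set.Subsingleton.measure_zero (fun _ h _ h' => h.unique h') _
  filter_upwards [ae_all_iff.mpr hrat, measure_eq_zero_iff_ae_notMem.mp hleast] with s hs hns hs0
  obtain ⟨y, hy0, hys⟩ : ∃ y, upperTail g y = 0 ∧ y < s := by
    by_contra! h
    exact hns ⟨hs0, h⟩
  obtain ⟨t, hyt, hts⟩ := exists_rat_btwn hys
  exact hs t (le_antisymm (hy0 ▸ antitone_upperTail hyt.le) bot_le) hts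

/-- The lower set on which the `n`-th truncation of `g` lives. Bounding the tail away from zero
makes functions that are integrable against the tail integrable there. -/
def truncationSet (g : ℝ → ℝ≥0) (n : ℕ) : Set ℝ :=
  {s | s < n ∧ (n : ℝ≥0∞)⁻¹ < upperTail g s}

/-- Bounded weights increasing to `g` almost everywhere. -/
noncomputable def truncation (g : ℝ → ℝ≥0) (n : ℕ) : ℝ → ℝ :=
  (truncationSet g n).indicator fun s => min (g s : ℝ) n

variable {n : ℕ}

theorem isLowerSet_truncationSet : IsLowerSet (truncationSet g n) := fun _ _ h hs =>
  ⟨h.trans_lt hs.1, hs.2.trans_le (antitone_upperTail h)⟩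

theorem truncationSet_subset_Iic : truncationSet g n ⊆ Set.Iic n := fun _ hs => hs.1.le

theorem measurableSet_truncationSet : MeasurableSet (truncationSet g n) :=
  isLowerSet_truncationSet.ordConnected.measurableSet

theorem measurable_truncation (hg : Measurable g) : Measurable (truncation g n) :=
  (hg.coe_nnreal_real.min measurable_const).indicator measurableSet_truncationSet

theorem truncation_nonneg (s : ℝ) : 0 ≤ truncation g n s :=
  Set.indicator_nonneg (fun _ _ => le_min (NNReal.coe_nonneg _) n.cast_nonneg) s

theorem abs_truncation_le (s : ℝ) : |truncation g n s| ≤ n := by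
  rw [abs_of_nonneg (truncation_nonneg s)]
  exact Set.indicator_le_self' (fun _ _ => le_min (NNReal.coe_nonneg _) n.cast_nonneg) s
    |>.trans (min_le_right _ _)

theorem truncation_le (s : ℝ) : truncation g n s ≤ g s :=
  Set.indicator_le_self' (fun _ _ => le_min (NNReal.coe_nonneg _) n.cast_nonneg) s
    |>.trans (min_le_left _ _)

theorem truncation_eq_zero {s : ℝ} (hs : s ∉ truncationSet g n) : truncation g n s = 0 :=
  Set.indicator_of_notMem hs _

theorem ae_tendsto_truncation (hg : Measurable g) :
    ∀ᵐ s, Tendsto (fun n => truncation g n s) atTop (𝓝 (g s)) := by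
  filter_upwards [ae_eq_zero_of_upperTail_eq_zero hg] with s hs
  by_cases htail : upperTail g s = 0
  · have hzero (n) : truncation g n s = g s :=
      le_antisymm (truncation_le s) (by
        simpa only [hs htail, NNReal.coe_zero] using truncation_nonneg s)
    simp only [hzero, tendsto_const_nhds]
  · refine tendsto_const_nhds.congr' ?_
    filter_upwards [(tendsto_order.mp ENNReal.tendsto_inv_nat_nhds_zero).2 _
      (pos_iff_ne_zero.mpr htail), eventually_gt_atTop ⌈max s (g s)⌉₊] with n hn hsn
    have hmax : max s (g s) < n := Nat.lt_of_ceil_lt hsn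
    have hmem : s ∈ truncationSet g n := ⟨(le_max_left _ _).trans_lt hmax, hn⟩
    rw [truncation, Set.indicator_of_mem hmem,
      min_eq_left ((le_max_right _ _).trans hmax.le)]

theorem abs_setIntegral_truncation_le (hg : Measurable g) (hy : upperTail g y ≠ ∞) :
    |∫ s in Set.Ioi y, truncation g n s| ≤ (upperTail g y).toReal := by
  rw [← setIntegral_Ioi_eq_toReal_upperTail hg,
    abs_of_nonneg (integral_nonneg fun s => truncation_nonneg s)]
  exact integral_mono_of_nonneg (.of_forall truncation_nonneg)
    (integrableOn_Ioi_of_upperTail_ne_top hg hy) (.of_forall truncation_le)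

theorem tendsto_setIntegral_truncation (hg : Measurable g) (hy : upperTail g y ≠ ∞) :
    Tendsto (fun n => ∫ s in Set.Ioi y, truncation g n s) atTop (𝓝 (upperTail g y).toReal) := by
  rw [← setIntegral_Ioi_eq_toReal_upperTail hg]
  refine tendsto_integral_of_dominated_convergence _
    (fun n => (measurable_truncation hg).aestronglyMeasurable)
    (integrableOn_Ioi_of_upperTail_ne_top hg hy) (fun n => .of_forall fun s => ?_)
    (ae_restrict_of_ae (ae_tendsto_truncation hg))
  rw [Real.norm_eq_abs, abs_of_nonneg (truncation_nonneg s)]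
  exact truncation_le s

variable {X : Type*} [MeasurableSpace X] {μ : Measure X} {q A B : X → ℝ}

theorem measurable_upperTail : Measurable (upperTail g) := antitone_upperTail.measurable

theorem restrict_preimage_truncationSet_le (hq : Measurable q) :
    μ.restrict (q ⁻¹' truncationSet g n)
      ≤ (n : ℝ≥0∞) • μ.withDensity fun x => upperTail g (q x) := by
  rw [← withDensity_indicator_one (hq measurableSet_truncationSet),
    ← withDensity_smul (f := fun x => upperTail g (q x)) _ (measurable_upperTail.comp hq)]
  refine withDensity_mono (.of_forall (Set.indicator_le fun x hx => ?_))
  have hn : (n : ℝ≥0∞) ≠ 0 := by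
    rintro hn
    simpa only [hn, ENNReal.inv_zero, not_top_lt] using hx.2
  calc (1 : ℝ≥0∞) = n * (n : ℝ≥0∞)⁻¹ := (ENNReal.mul_inv_cancel hn (ENNReal.natCast_ne_top n)).symm
    _ ≤ n * upperTail g (q x) := by gcongr; exact hx.2.le

theorem integrableOn_preimage_truncationSet (hq : Measurable q)
    (hB : Integrable B (μ.withDensity fun x => upperTail g (q x))) :
    IntegrableOn B (q ⁻¹' truncationSet g n) μ :=
  (hB.smul_measure (ENNReal.natCast_ne_top n)).mono_measure (restrict_preimage_truncationSet_le hq)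

theorem integral_withDensity_comp_eq_upperTail (hq : Measure.QuasiMeasurePreserving q μ)
    (hq0 : ∀ x, 0 ≤ q x) (hg : Measurable g) (hfin : ∀ᵐ x ∂μ, upperTail g (q x) ≠ ∞)
    (hA : AEStronglyMeasurable A μ) (hB : AEStronglyMeasurable B μ)
    (hgA : Integrable A (μ.withDensity fun x => g (q x)))
    (hgB : Integrable B (μ.withDensity fun x => upperTail g (q x)))
    (hAn : ∀ n, IntegrableOn A (q ⁻¹' truncationSet g n) μ)
    (h : ∀ n, ∀ k : ℝ → ℝ, ∀ C, Continuous k → (∀ s, |k s| ≤ C) →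
      (∀ s ∉ truncationSet g n, k s = 0) →
      ∫ x, k (q x) * A x ∂μ = ∫ x, (∫ s in Set.Ioi (q x), k s) * B x ∂μ) :
    ∫ x, A x ∂(μ.withDensity fun x => g (q x))
      = ∫ x, B x ∂(μ.withDensity fun x => upperTail g (q x)) := by
  have hgq : Measurable fun x => g (q x) := hg.comp hq.measurable
  have htail : Measurable fun x => upperTail g (q x) := measurable_upperTail.comp hq.measurable
  have hlt : ∀ᵐ x ∂μ, upperTail g (q x) < ∞ := hfin.mono fun x hx => hx.lt_top
  have hbounded (n) : ∫ x, truncation g n (q x) * A x ∂μ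
      = ∫ x, (∫ s in Set.Ioi (q x), truncation g n s) * B x ∂μ :=
    integral_comp_mul_eq_of_continuous hq hq0 isLowerSet_truncationSet truncationSet_subset_Iic
      hA hB (hAn n) (integrableOn_preimage_truncationSet hq.measurable hgB) (h n)
      (measurable_truncation hg) abs_truncation_le fun _ => truncation_eq_zero
  rw [integral_withDensity_eq_integral_smul hgq,
    integral_withDensity_eq_integral_toReal_smul htail hlt]
  have hleft := tendsto_integral_mul (w := fun n x => truncation g n (q x)) hA
    (fun n => ((measurable_truncation hg).comp hq.measurable).aestronglyMeasurable)
    ((integrable_withDensity_iff_integrable_smul hgq).mp hgA)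
    (fun n => .of_forall fun x =>
      (abs_of_nonneg (truncation_nonneg _)).trans_le (truncation_le _))
    (hq.ae (ae_tendsto_truncation hg))
  have hright := tendsto_integral_mul (w := fun n x => ∫ s in Set.Ioi (q x), truncation g n s) hB
    (fun n => ((continuous_setIntegral_Ioi truncationSet_subset_Iic (fun _ => truncation_eq_zero)
      (locallyIntegrable_of_abs_le (measurable_truncation hg) abs_truncation_le)).measurable.comp
        hq.measurable).aestronglyMeasurable)
    ((integrable_withDensity_iff_integrable_smul' htail hlt).mp hgB)
    (fun n => hfin.mono fun x hx => abs_setIntegral_truncation_le hg hx)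
    (hfin.mono fun x hx => tendsto_setIntegral_truncation hg hx)
  exact tendsto_nhds_unique hleft (hright.congr fun n => (hbounded n).symm)

end UpperTail

section EigenvalueExpectations

variable {p m r : ℕ} {X : Type*} [MeasurableSpace X] {μ ν : Measure X}

/-- The summands of the Stein–Haff expression, evaluated at random eigenvalues `l`, have finite
expectations under `μ`. -/
structure IntegrableTerms (φ : Fin r → (Fin r → ℝ) → ℝ) (l : X → Fin r → ℝ) (μ : Measure X) :
    Prop where
  apply : ∀ i, Integrable (fun x => φ i (l x)) μ
  mul_partialDeriv : ∀ i, Integrable (fun x => l x i * partialDeriv (φ i) i (l x)) μ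
  div_sub : ∀ i j, j ≠ i →
    Integrable (fun x => (l x i * φ i (l x) - l x j * φ j (l x)) / (l x i - l x j)) μ

theorem IntegrableTerms.mono {φ : Fin r → (Fin r → ℝ) → ℝ} {l : X → Fin r → ℝ} {c : ℝ≥0∞}
    (h : IntegrableTerms φ l μ) (hc : c ≠ ∞) (hν : ν ≤ c • μ) : IntegrableTerms φ l ν where
  apply i := ((h.apply i).smul_measure hc).mono_measure hν
  mul_partialDeriv i := ((h.mul_partialDeriv i).smul_measure hc).mono_measure hν
  div_sub i j hij := ((h.div_sub i j hij).smul_measure hc).mono_measure hν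

theorem IntegrableTerms.discRate {φ : Fin r → (Fin r → ℝ) → ℝ} {l : X → Fin r → ℝ}
    (h : IntegrableTerms φ l μ) : Integrable (fun x => discRate φ (l x)) μ :=
  ((integrable_finsetSum _ fun i _ => integrable_finsetSum _ fun j hj =>
    (h.div_sub j i (Finset.mem_Ioi.mp hj).ne).const_mul 2).const_mul 2).add
    (integrable_finsetSum _ fun i _ => (h.apply i).const_mul 2)

variable {φ : Fin (min p m) → (Fin (min p m) → ℝ) → ℝ}

theorem IntegrableTerms.steinHaff {l : X → Fin (min p m) → ℝ} (h : IntegrableTerms φ l μ) :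
    Integrable (fun x => steinHaff p m φ (l x)) μ := by
  refine integrable_finsetSum _ fun i _ => (((h.apply i).const_mul _).add ?_).add
    (integrable_finsetSum _ fun j hj => h.div_sub i j (Finset.ne_of_mem_erase hj))
  simpa only [mul_assoc] using (h.mul_partialDeriv i).const_mul 2

theorem aestronglyMeasurable_of_continuousAt {F : (Fin m → Fin p → ℝ) → ℝ}
    (hF : ∀ u, eig u ∈ chamber (min p m) → ContinuousAt F u) : AEStronglyMeasurable F := by
  have hcont : ContinuousOn F {u | eig u ∈ chamber (min p m)} := fun u hu =>
    (hF u hu).continuousWithinAt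
  have hmeas := hcont.aestronglyMeasurable (μ := volume) isOpen_setOf_eig_mem_chamber.measurableSet
  rwa [Measure.restrict_eq_self_of_ae_mem (s := {u | eig u ∈ chamber (min p m)})
    ae_eig_mem_chamber] at hmeas

variable (hφ : ∀ l ∈ chamber (min p m), ∀ i, DifferentiableAt ℝ (φ i) l)
include hφ

theorem aestronglyMeasurable_steinHaff :
    AEStronglyMeasurable fun u : Fin m → Fin p → ℝ => steinHaff p m φ (eig u) := by
  have heig (i) : AEMeasurable fun u : Fin m → Fin p → ℝ => eig u i :=
    (aestronglyMeasurable_of_continuousAt fun u hu =>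
      (continuous_apply i).continuousAt.comp (differentiableAt_eig hu).continuousAt).aemeasurable
  have hval (i) : AEMeasurable fun u : Fin m → Fin p → ℝ => φ i (eig u) :=
    (aestronglyMeasurable_of_continuousAt fun u hu =>
      (hφ _ hu i).continuousAt.comp (differentiableAt_eig hu).continuousAt).aemeasurable
  have hderiv (i) : AEMeasurable fun u : Fin m → Fin p → ℝ => partialDeriv (φ i) i (eig u) :=
    (measurable_fderiv_apply_const ℝ (φ i) (Pi.single i 1)).comp_aemeasurable
      (aemeasurable_pi_lambda _ heig)
  refine AEMeasurable.aestronglyMeasurable (Finset.aemeasurable_fun_sum _ fun i _ =>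
    (((hval i).const_mul _).add (((heig i).const_mul _).mul (hderiv i))).add
      (Finset.aemeasurable_fun_sum _ fun j _ => ?_))
  exact (((heig i).mul (hval i)).sub ((heig j).mul (hval j))).div ((heig i).sub (heig j))

variable {Sig : Matrix (Fin p) (Fin p) ℝ}

theorem aestronglyMeasurable_fderiv_rowForm_spectralField :
    AEStronglyMeasurable fun u : Fin m → Fin p → ℝ =>
      fderiv ℝ (rowForm Sig) u (spectralField φ u) :=
  aestronglyMeasurable_of_continuousAt fun _ hu =>
    ((contDiff_rowForm Sig (n := 1)).continuous_fderiv one_ne_zero).continuousAt.clm_apply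
      (differentiableAt_spectralField hu (hφ _ hu)).continuousAt

theorem integral_comp_rowForm_mul_fderiv (hSig : Sig.PosDef) {D : Set ℝ} {t : ℝ}
    (hD : IsLowerSet D) (hDt : D ⊆ Set.Iic t)
    (hint : IntegrableOn (fun u : Fin m → Fin p → ℝ => steinHaff p m φ (eig u)) (rowForm Sig ⁻¹' D))
    (hint_fderiv : IntegrableOn (fun u : Fin m → Fin p → ℝ =>
      fderiv ℝ (rowForm Sig) u (spectralField φ u)) (rowForm Sig ⁻¹' D))
    (hint_disc : IntegrableOn (fun u : Fin m → Fin p → ℝ => discRate φ (eig u)) (rowForm Sig ⁻¹' D))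
    {k : ℝ → ℝ} {C : ℝ} (hk : Continuous k) (hC : ∀ s, |k s| ≤ C) (hkD : ∀ s ∉ D, k s = 0) :
    ∫ u : Fin m → Fin p → ℝ, k (rowForm Sig u) * fderiv ℝ (rowForm Sig) u (spectralField φ u)
      = ∫ u : Fin m → Fin p → ℝ,
          (∫ s in Set.Ioi (rowForm Sig u), k s) * steinHaff p m φ (eig u) := by
  set w : (Fin m → Fin p → ℝ) → ℝ := fun u => ∫ s in Set.Ioi (rowForm Sig u), k s
  have hrow : Differentiable ℝ (rowForm (m := m) Sig) :=
    (contDiff_rowForm Sig (n := 1)).differentiable one_ne_zero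
  have hw' (u) : HasFDerivAt w (-k (rowForm Sig u) • fderiv ℝ (rowForm Sig) u) u :=
    (hasDerivAt_setIntegral_Ioi hDt hkD hk _).comp_hasFDerivAt u (hrow u).hasFDerivAt
  have hw : Differentiable ℝ w := fun u => (hw' u).differentiableAt
  have hw0 (u) (hu : u ∉ rowForm Sig ⁻¹' D) : w u = 0 := setIntegral_Ioi_eq_zero hD hkD hu
  have hfderiv (u) : fderiv ℝ w u (spectralField φ u)
      = -(k (rowForm Sig u) * fderiv ℝ (rowForm Sig) u (spectralField φ u)) := by
    rw [(hw' u).fderiv, _root_.smul_apply, smul_eq_mul, neg_mul]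
  have hDm : MeasurableSet (rowForm (m := m) Sig ⁻¹' D) :=
    (continuous_rowForm Sig).measurable hD.ordConnected.measurableSet
  have hmul {F : (Fin m → Fin p → ℝ) → ℝ} (hF : IntegrableOn F (rowForm Sig ⁻¹' D)) :
      Integrable fun u => w u * F u :=
    integrable_mul_of_abs_le hDm hF hw.continuous.aestronglyMeasurable
      (fun u => abs_setIntegral_Ioi_le hDt hkD hC (rowForm_nonneg hSig u)) hw0
  have hsupp : HasCompactSupport w := HasCompactSupport.intro (isCompact_setOf_rowForm_le hSig t)
    fun u hu => hw0 u fun huD => hu (hDt huD)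
  have hparts := integral_mul_steinHaff hφ hw hsupp (hmul hint)
    (by
      simp only [hfderiv]
      exact (integrable_mul_of_abs_le hDm hint_fderiv
        (hk.comp (continuous_rowForm Sig)).aestronglyMeasurable (fun u => hC _)
        fun u hu => hkD _ hu).neg)
    (hmul hint_disc)
  simp only [hfderiv, integral_neg, neg_neg] at hparts
  exact hparts.symm

theorem integrableOn_fderiv_rowForm_spectralField (hSig : Sig.PosDef) {D : Set ℝ} {t : ℝ}
    (hD : MeasurableSet D) (hDt : D ⊆ Set.Iic t)
    (hint : ∀ i, IntegrableOn (fun u : Fin m → Fin p → ℝ => φ i (eig u)) (rowForm Sig ⁻¹' D)) :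
    IntegrableOn (fun u : Fin m → Fin p → ℝ => fderiv ℝ (rowForm Sig) u (spectralField φ u))
      (rowForm Sig ⁻¹' D) := by
  refine Integrable.mono'
    ((integrable_finsetSum Finset.univ fun i _ => (hint i).abs).const_mul (2 * t))
    (aestronglyMeasurable_fderiv_rowForm_spectralField hφ).restrict ?_
  filter_upwards [ae_restrict_mem ((continuous_rowForm Sig).measurable hD),
    ae_restrict_of_ae ae_eig_mem_chamber] with u huD hu
  obtain ⟨H, hH⟩ := exists_isEigenvectorMatrix u
  rw [fderiv_rowForm_spectralField hSig φ hu hH, Real.norm_eq_abs, abs_mul, abs_two, mul_assoc]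
  gcongr
  exact (abs_traceTerm_le hSig φ hH).trans (by gcongr; exact hDt huD)

theorem integral_traceTerm_withDensity_rowForm (hSig : Sig.PosDef) (hp : 0 < p) (hm : 0 < m)
    {H : (Fin m → Fin p → ℝ) → Matrix (Fin p) (Fin (min p m)) ℝ}
    (hH : ∀ᵐ u, IsEigenvectorMatrix u (H u)) {g : ℝ → ℝ≥0} (hg : Measurable g)
    (hfin : ∀ᵐ u : Fin m → Fin p → ℝ, upperTail g (rowForm Sig u) ≠ ∞)
    (htrace : Integrable (fun u => traceTerm Sig (H u) (eig u) φ)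
      (volume.withDensity fun u => g (rowForm Sig u)))
    (hterms : IntegrableTerms φ eig
      (volume.withDensity fun u : Fin m → Fin p → ℝ => upperTail g (rowForm Sig u))) :
    2 * ∫ u, traceTerm Sig (H u) (eig u) φ ∂(volume.withDensity fun u => g (rowForm Sig u))
      = ∫ u : Fin m → Fin p → ℝ, steinHaff p m φ (eig u)
          ∂(volume.withDensity fun u => upperTail g (rowForm Sig u)) := by
  have hq := quasiMeasurePreserving_rowForm hSig hp hm
  have hrestrict (n) := hterms.mono (ENNReal.natCast_ne_top n)
    (restrict_preimage_truncationSet_le hq.measurable)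
  have hfderiv_int (n) := integrableOn_fderiv_rowForm_spectralField hφ hSig
    (measurableSet_truncationSet (g := g) (n := n)) truncationSet_subset_Iic (hrestrict n).apply
  have hfderiv : (fun u => 2 * traceTerm Sig (H u) (eig u) φ)
      =ᵐ[volume.withDensity fun u => (g (rowForm Sig u) : ℝ≥0∞)]
        fun u => fderiv ℝ (rowForm Sig) u (spectralField φ u) := by
    refine (withDensity_absolutelyContinuous _ _).ae_eq ?_
    filter_upwards [hH, ae_eig_mem_chamber] with u hHu hu
    exact (fderiv_rowForm_spectralField hSig φ hu hHu).symm
  rw [← integral_const_mul, integral_congr_ae hfderiv]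
  exact integral_withDensity_comp_eq_upperTail hq (rowForm_nonneg hSig) hg hfin
    (aestronglyMeasurable_fderiv_rowForm_spectralField hφ) (aestronglyMeasurable_steinHaff hφ)
    ((htrace.const_mul 2).congr hfderiv) hterms.steinHaff hfderiv_int
    fun n k C hk hC hkD => integral_comp_rowForm_mul_fderiv hφ hSig isLowerSet_truncationSet
      truncationSet_subset_Iic (hrestrict n).steinHaff (hfderiv_int n) (hrestrict n).discRate
      hk hC hkD

end EigenvalueExpectations

section WithDensityProd

variable {X Y : Type*} [MeasurableSpace X] [MeasurableSpace Y] {μ : Measure X} {ν : Measure Y}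
  [SFinite μ] [SFinite ν] {W : X × Y → ℝ≥0∞} {h : X × Y → ℝ}

theorem ae_integrable_withDensity_prodMk (hW : Measurable W)
    (hfin : ∀ᵐ x ∂μ.prod ν, W x ≠ ∞) (hh : Integrable h ((μ.prod ν).withDensity W)) :
    ∀ᵐ x ∂μ, Integrable (fun y => h (x, y)) (ν.withDensity fun y => W (x, y)) := by
  rw [integrable_withDensity_iff_integrable_smul' hW (hfin.mono fun _ => lt_top_iff_ne_top.mpr)]
    at hh
  filter_upwards [hh.prod_right_ae, Measure.ae_ae_of_ae_prod hfin] with x hx hx_fin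
  exact (integrable_withDensity_iff_integrable_smul' (hW.comp measurable_prodMk_left)
    (hx_fin.mono fun _ => lt_top_iff_ne_top.mpr)).mpr hx

theorem integral_withDensity_prod (hW : Measurable W)
    (hfin : ∀ᵐ x ∂μ.prod ν, W x ≠ ∞) (hh : Integrable h ((μ.prod ν).withDensity W)) :
    ∫ x, h x ∂((μ.prod ν).withDensity W)
      = ∫ x, ∫ y, h (x, y) ∂(ν.withDensity fun y => W (x, y)) ∂μ := by
  rw [integrable_withDensity_iff_integrable_smul' hW (hfin.mono fun _ => lt_top_iff_ne_top.mpr)]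
    at hh
  rw [integral_withDensity_eq_integral_toReal_smul hW
    (hfin.mono fun _ => lt_top_iff_ne_top.mpr), integral_prod _ hh]
  refine integral_congr_ae ?_
  filter_upwards [Measure.ae_ae_of_ae_prod hfin] with x hx_fin
  exact (integral_withDensity_eq_integral_toReal_smul (hW.comp measurable_prodMk_left)
    (hx_fin.mono fun _ => lt_top_iff_ne_top.mpr) _).symm

theorem IntegrableTerms.ae_prodMk {r : ℕ} {φ : Fin r → (Fin r → ℝ) → ℝ} {l : X × Y → Fin r → ℝ}
    (hterms : IntegrableTerms φ l ((μ.prod ν).withDensity W)) (hW : Measurable W)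
    (hfin : ∀ᵐ x ∂μ.prod ν, W x ≠ ∞) :
    ∀ᵐ x ∂μ, IntegrableTerms φ (fun y => l (x, y)) (ν.withDensity fun y => W (x, y)) := by
  filter_upwards [
    ae_all_iff.mpr fun i => ae_integrable_withDensity_prodMk hW hfin (hterms.apply i),
    ae_all_iff.mpr fun i => ae_integrable_withDensity_prodMk hW hfin (hterms.mul_partialDeriv i),
    ae_all_iff.mpr fun i => ae_all_iff.mpr fun j => ae_all_iff.mpr fun hij =>
      ae_integrable_withDensity_prodMk hW hfin (hterms.div_sub i j hij)]
    with x happly hpartial hdiv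
  exact ⟨happly, hpartial, hdiv⟩

end WithDensityProd

theorem upperTail_const_mul_comp_add (k : ℝ≥0) (f : ℝ → ℝ≥0) (c y : ℝ) :
    upperTail (fun s => k * f (c + s)) y = k * upperTail f (c + y) := by
  have hshift := (measurePreserving_add_left volume c).setLIntegral_comp_preimage_emb
    (MeasurableEquiv.addLeft c).measurableEmbedding (fun s => (f s : ℝ≥0∞)) (Set.Ioi (c + y))
  rw [Set.preimage_const_add_Ioi, add_sub_cancel_left] at hshift
  simp only [upperTail, ENNReal.coe_mul]
  rw [lintegral_const_mul' _ _ ENNReal.coe_ne_top, hshift]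

variable {p q m : ℕ} {Sig : Matrix (Fin p) (Fin p) ℝ} {θ : Matrix (Fin q) (Fin p) ℝ}

theorem measurable_ellDensity {g : ℝ → ℝ≥0∞} (hg : Measurable g) :
    Measurable (ellDensity (m := m) Sig θ g) := by
  have hsub : Continuous fun x : (Fin q → Fin p → ℝ) × (Fin m → Fin p → ℝ) =>
    (fun a b => x.1 a b - θ a b : Fin q → Fin p → ℝ) := by fun_prop
  have hquad : Continuous (quadForm (m := m) Sig θ) :=
    ((continuous_rowForm Sig).comp hsub).add ((continuous_rowForm Sig).comp continuous_snd)
  exact (hg.comp hquad.measurable).const_mul _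

theorem measurable_half_upperTail (f : ℝ → ℝ≥0) : Measurable fun t => 2⁻¹ * upperTail f t :=
  measurable_upperTail.const_mul _

section Slice

variable {φ : Fin (min p m) → (Fin (min p m) → ℝ) → ℝ}
  {H : (Fin m → Fin p → ℝ) → Matrix (Fin p) (Fin (min p m)) ℝ} {f : ℝ → ℝ≥0}

theorem integral_traceTerm_ellDensity_prodMk (hSig : Sig.PosDef) (hp : 0 < p) (hm : 0 < m)
    (hφ : ∀ i, DifferentiableOn ℝ (φ i) (chamber (min p m)))
    (hH : ∀ᵐ u, IsEigenvectorMatrix u (H u)) (hf : Measurable f) (z : Fin q → Fin p → ℝ)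
    (hfin : ∀ᵐ u : Fin m → Fin p → ℝ,
      ellDensity Sig θ (fun t => 2⁻¹ * upperTail f t) (z, u) ≠ ∞)
    (htrace : Integrable (fun u => traceTerm Sig (H u) (eig u) φ)
      (volume.withDensity fun u => ellDensity Sig θ (fun t => f t) (z, u)))
    (hterms : IntegrableTerms φ eig (volume.withDensity fun u : Fin m → Fin p → ℝ =>
      ellDensity Sig θ (fun t => 2⁻¹ * upperTail f t) (z, u))) :
    ∫ u, traceTerm Sig (H u) (eig u) φ
        ∂(volume.withDensity fun u => ellDensity Sig θ (fun t => f t) (z, u))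
      = ∫ u : Fin m → Fin p → ℝ, steinHaff p m φ (eig u)
          ∂(volume.withDensity fun u =>
            ellDensity Sig θ (fun t => 2⁻¹ * upperTail f t) (z, u)) := by
  set k : ℝ≥0 := (Sig.det ^ (-((q + m : ℕ) : ℝ) / 2)).toNNReal
  set c : ℝ := rowForm Sig fun a b => z a b - θ a b
  set g : ℝ → ℝ≥0 := fun s => 2⁻¹ * k * f (c + s)
  have hg : Measurable g := (hf.comp (measurable_const_add c)).const_mul _
  have hg_row : Measurable fun u : Fin m → Fin p → ℝ => (g (rowForm Sig u) : ℝ≥0∞) :=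
    (hg.comp (continuous_rowForm Sig).measurable).coe_nnreal_ennreal
  have htail : (fun u : Fin m → Fin p → ℝ => ellDensity Sig θ (fun t => 2⁻¹ * upperTail f t) (z, u))
      = fun u => upperTail g (rowForm Sig u) := by
    funext u
    rw [upperTail_const_mul_comp_add, ENNReal.coe_mul, ENNReal.coe_inv two_ne_zero,
      ENNReal.coe_ofNat, mul_comm (2⁻¹ : ℝ≥0∞), mul_assoc]
    rfl
  have hdens : (volume.withDensity fun u : Fin m → Fin p → ℝ =>
      ellDensity Sig θ (fun t => (f t : ℝ≥0∞)) (z, u))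
        = (2 : ℝ≥0∞) • volume.withDensity fun u => (g (rowForm Sig u) : ℝ≥0∞) := by
    rw [← withDensity_smul _ hg_row]
    congr 1
    funext u
    have hcancel : 2 * g (rowForm Sig u) = k * f (c + rowForm Sig u) := by
      simp only [g, mul_assoc, mul_inv_cancel_left₀ (two_ne_zero (α := ℝ≥0))]
    rw [Pi.smul_apply, smul_eq_mul, ← ENNReal.coe_ofNat, ← ENNReal.coe_mul, hcancel,
      ENNReal.coe_mul]
    rfl
  rw [htail] at hterms ⊢
  rw [hdens, integrable_smul_measure two_ne_zero ENNReal.ofNat_ne_top] at htrace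
  rw [hdens, integral_smul_measure, ENNReal.toReal_ofNat, smul_eq_mul]
  exact integral_traceTerm_withDensity_rowForm
    (fun l hl i => (hφ i).differentiableAt ((isOpen_chamber _).mem_nhds hl)) hSig hp hm hH hg
    (by simpa only [← funext_iff.mp htail] using hfin) htrace hterms

end Slice

section LawStar

variable {f : ℝ → ℝ}

theorem measurable_ellDensity_Fstar : Measurable (ellDensity (m := m) Sig θ (Fstar f)) :=
  measurable_ellDensity (measurable_half_upperTail fun t => (f t).toNNReal)

theorem Kstar_smul_lawStar (hK : Kstar m Sig θ f ≠ ∞) :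
    Kstar m Sig θ f • lawStar m Sig θ f = volume.withDensity (ellDensity Sig θ (Fstar f)) := by
  have hdens := measurable_ellDensity_Fstar (m := m) (Sig := Sig) (θ := θ) (f := f)
  by_cases hK0 : Kstar m Sig θ f = 0
  · rw [hK0, zero_smul, withDensity_congr_ae ((lintegral_eq_zero_iff hdens).mp hK0),
      withDensity_zero]
  · have hlaw : lawStar m Sig θ f
        = (Kstar m Sig θ f)⁻¹ • volume.withDensity (ellDensity Sig θ (Fstar f)) :=
      withDensity_smul _ hdens
    rw [hlaw, smul_smul, ENNReal.mul_inv_cancel hK0 hK, one_smul]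

end LawStar

end EllipticalModel

open EllipticalModel in
theorem corollaryA1_general {p q m : ℕ}
    {Sig : Matrix (Fin p) (Fin p) ℝ} (hSig : Sig.PosDef) {θ : Matrix (Fin q) (Fin p) ℝ}
    {f : ℝ → NNReal} (hf : Measurable f)
    (hfin : ∀ᵐ x : (Fin q → Fin p → ℝ) × (Fin m → Fin p → ℝ),
      ellDensity Sig θ (fun t => 2⁻¹ * upperTail f t) x ≠ ∞)
    {H : (Fin m → Fin p → ℝ) → Matrix (Fin p) (Fin (min p m)) ℝ}
    (hH : ∀ᵐ u, IsEigenvectorMatrix u (H u))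
    {φ : Fin (min p m) → (Fin (min p m) → ℝ) → ℝ}
    (hφ : ∀ i, DifferentiableOn ℝ (φ i) (chamber (min p m)))
    (htrace : Integrable (fun x => traceTerm Sig (H x.2) (eig x.2) φ)
      (volume.withDensity (ellDensity Sig θ fun t => f t)))
    (hterms : IntegrableTerms φ (fun x => eig x.2)
      (volume.withDensity (ellDensity Sig θ fun t => 2⁻¹ * upperTail f t))) :
    ∫ x, traceTerm Sig (H x.2) (eig x.2) φ
        ∂(volume.withDensity (ellDensity Sig θ fun t => f t))
      = ∫ x, steinHaff p m φ (eig x.2)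
          ∂(volume.withDensity (ellDensity Sig θ fun t => 2⁻¹ * upperTail f t)) := by
  rcases Nat.eq_zero_or_pos (min p m) with hr | hr
  · have : IsEmpty (Fin (min p m)) := by rw [hr]; infer_instance
    simp [traceTerm, steinHaff, Matrix.trace, Matrix.mul_apply]
  have hdens := measurable_ellDensity (m := m) (Sig := Sig) (θ := θ) hf.coe_nnreal_ennreal
  have hdens_fin : ∀ᵐ x : (Fin q → Fin p → ℝ) × (Fin m → Fin p → ℝ),
      ellDensity Sig θ (fun t => (f t : ℝ≥0∞)) x ≠ ∞ :=
    ae_of_all _ fun x => ENNReal.mul_ne_top ENNReal.ofReal_ne_top ENNReal.coe_ne_top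
  have htail := measurable_ellDensity (m := m) (Sig := Sig) (θ := θ) (measurable_half_upperTail f)
  have hsteinHaff := hterms.steinHaff
  rw [Measure.volume_eq_prod] at hfin hdens_fin htrace hterms hsteinHaff ⊢
  rw [integral_withDensity_prod hdens hdens_fin htrace,
    integral_withDensity_prod htail hfin hsteinHaff]
  refine integral_congr_ae ?_
  filter_upwards [Measure.ae_ae_of_ae_prod hfin,
    ae_integrable_withDensity_prodMk hdens hdens_fin htrace,
    hterms.ae_prodMk htail hfin] with z hz hz_trace hz_terms
  exact integral_traceTerm_ellDensity_prodMk hSig (lt_min_iff.mp hr).1 (lt_min_iff.mp hr).2 hφ hH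
    hf z hz hz_trace hz_terms

theorem corollaryA1 (p q m : ℕ)
    (Sig : Matrix (Fin p) (Fin p) ℝ) (hSig : Sig.PosDef)
    (θ : Matrix (Fin q) (Fin p) ℝ)
    (f : ℝ → ℝ) (hf_meas : Measurable f) (hf_nonneg : ∀ t, 0 ≤ t → 0 ≤ f t)
    (hf_prob : IsProbabilityMeasure (EllipticalModel.law m Sig θ f))
    (hK : EllipticalModel.Kstar m Sig θ f ≠ ∞)
    (H : (Fin m → Fin p → ℝ) → Matrix (Fin p) (Fin (min p m)) ℝ)
    (hH : ∀ᵐ u, EllipticalModel.IsEigenvectorMatrix u (H u))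
    (φ : Fin (min p m) → (Fin (min p m) → ℝ) → ℝ)
    (hφ : ∀ i, DifferentiableOn ℝ (φ i) (EllipticalModel.chamber (min p m)))
    (hE : Integrable
      (fun x => EllipticalModel.traceTerm Sig (H x.2) (EllipticalModel.eig x.2) φ)
      (EllipticalModel.law m Sig θ f))
    -- the expectations of the individual terms on the right-hand side exist
    (hE1 : ∀ i, Integrable (fun x => φ i (EllipticalModel.eig x.2))
      (EllipticalModel.lawStar m Sig θ f))
    (hE2 : ∀ i, Integrable
      (fun x => EllipticalModel.eig x.2 i *
        EllipticalModel.partialDeriv (φ i) i (EllipticalModel.eig x.2))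
      (EllipticalModel.lawStar m Sig θ f))
    (hE3 : ∀ i j, j ≠ i → Integrable
      (fun x =>
        (EllipticalModel.eig x.2 i * φ i (EllipticalModel.eig x.2)
          - EllipticalModel.eig x.2 j * φ j (EllipticalModel.eig x.2))
        / (EllipticalModel.eig x.2 i - EllipticalModel.eig x.2 j))
      (EllipticalModel.lawStar m Sig θ f)) :
    ∫ x, EllipticalModel.traceTerm Sig (H x.2) (EllipticalModel.eig x.2) φ
        ∂(EllipticalModel.law m Sig θ f)
      = (EllipticalModel.Kstar m Sig θ f).toReal *
        ∫ x, ∑ i : Fin (min p m),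
          ((((max p m : ℕ) : ℝ) - ((min p m : ℕ) : ℝ) + 1) * φ i (EllipticalModel.eig x.2)
            + 2 * EllipticalModel.eig x.2 i *
                EllipticalModel.partialDeriv (φ i) i (EllipticalModel.eig x.2)
            + ∑ j ∈ Finset.univ.erase i,
                (EllipticalModel.eig x.2 i * φ i (EllipticalModel.eig x.2)
                  - EllipticalModel.eig x.2 j * φ j (EllipticalModel.eig x.2))
                / (EllipticalModel.eig x.2 i - EllipticalModel.eig x.2 j))
        ∂(EllipticalModel.lawStar m Sig θ f) := by
  have hstar := EllipticalModel.Kstar_smul_lawStar hK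
  rw [← smul_eq_mul, ← integral_smul_measure, hstar]
  exact corollaryA1_general hSig hf_meas.real_toNNReal
    ((ae_lt_top EllipticalModel.measurable_ellDensity_Fstar hK).mono fun _ => ne_of_lt) hH hφ hE
    (EllipticalModel.IntegrableTerms.mono ⟨hE1, hE2, hE3⟩ hK hstar.ge)
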